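/- Let $X$ be a complex Banach space and let $A$ be the infinitesimal generator of a $C_0$-semigroup $T:[0,\infty)\to B(X)$; write $\sigma(A)$, $\rho(A)$ for its spectrum and resolvent set and $R(z,A)=(A-zI)^{-1}$ for $z\in\rho(A)$. Let $L^1_s(\mathbb R,B(X))$ be the set of $K:\mathbb R\to B(X)$ such that $s\mapsto K(s)v$ is (strongly) measurable for every $v\in X$ and $\|K(s)\|\le f(s)$ a.e. for some $f\in L^1(\mathbb R)$; $\|K\|_1$ is the infimum of $\|f\|_{L^1}$ over such $f$. Let $\mathcal F=\mathcal F(\mathbb R,X)$ be a homogeneous Banach function space, that is, a complex Banach space of (a.e. classes of) functions $\mathbb R\to X$ such that: (1) $\mathcal F$ is continuously embedded in the Stepanov space with norm $\sup_{t\in\mathbb R}\int_0^1\|x(s+t)\|\,ds$; (2) for $t\in\mathbb R$, $x\in\mathcal F$ the translate $x(t+\cdot)$ lies in $\mathcal F$ and has the same norm as $x$; (3) for $C\in B(X)$, $x\in\mathcal F$ the function $t\mapsto C(x(t))$ lies in $\mathcal F$ with norm at most $\|C\|\|x\|$; (4) for $K\in L^1_s(\mathbb R,B(X))$, $x\in\mathcal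 F$ the convolution $(K*x)(t)=\int_{\mathbb R}K(s)x(t-s)\,ds$ lies in $\mathcal F$ with norm at most $\|K\|_1\|x\|$; (5) if $x\in\mathcal F$ and $f*x=0$ for all $f\in L^1(\mathbb R)$, then $x=0$. For $f\in L^1(\mathbb R)$ put $\hat f(\lambda)=\int_{\mathbb R} f(t)e^{-it\lambda}\,dt$. The Beurling spectrum $\Lambda(x)$ of $x\in\mathcal F$ is the complement in $\mathbb R$ of the set of $\lambda$ for which there is $f\in L^1(\mathbb R)$ with $\hat f(\lambda)\neq0$ and $f*x=0$; for $\Delta\subset\mathbb R$ put $\mathcal F(\Delta)=\{x\in\mathcal F:\Lambda(x)\subseteq\Delta\}$. The operator $\mathscr L=-d/dt+A$ in $\mathcal F$ is defined as follows: $x\in D(\mathscr L)$ and $\mathscr Lx=y$ if $x,y\in\mathcal F$ and (for a representative of $x$) $$x(t)=T(t-s)x(s)-\int_s^tT(t-\tau)y(\tau)\,d\tau\qquad\text{for all } s\le t .$$ Denote by $\mathscr L_{\mathcal F(\Delta)}$ the operator defined in the same way with $x,y\in\mathcal F(\Delta)$. **Theorem.** Let $\Delta\subset\mathbb R$ be compact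 with $i\Delta\cap\sigma(A)=\emptyset$. Then $\mathscr Lx\in\mathcal F(\Delta)$ whenever $x\in D(\mathscr L)\cap\mathcal F(\Delta)$, so that $\mathscr L_{\mathcal F(\Delta)}$ is the restriction of $\mathscr L$ to $\mathcal F(\Delta)$, and $\mathscr L_{\mathcal F(\Delta)}$ is a (well-defined, i.e. single-valued) invertible operator: its kernel is $\{0\}$ and its range is $\mathcal F(\Delta)$. Moreover, there are functions $\varphi\in C^\infty(\mathbb R,\mathbb C)$ with compact support that equal $1$ in a neighbourhood of $\Delta$ and satisfy $i\operatorname{supp}\varphi\subset\rho(A)$; and for every such $\varphi$ the function $$F(t)=\frac1{2\pi}\int_{\mathbb R}\varphi(\lambda)R(i\lambda,A)e^{i\lambda t}\,d\lambda$$ belongs to $L^1(\mathbb R,B(X))$ and, for every $y\in\mathcal F(\Delta)$, the function $F*y$ belongs to $D(\mathscr L_{\mathcal F(\Delta)})$ and $\mathscr L_{\mathcal F(\Delta)}(F*y)=y$. -/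

import Mathlib

open MeasureTheory Filter Topology
open scoped NNReal ENNReal ContDiff

noncomputable section

/-- A `C₀`-semigroup `T : [0, ∞) → B(X)` of bounded operators on `X`. -/
structure C0Semigroup (X : Type*) [NormedAddCommGroup X] [NormedSpace ℂ X] where
  /-- the operators of the semigroup -/
  op : ℝ≥0 → X →L[ℂ] X
  op_zero : op 0 = ContinuousLinearMap.id ℂ X
  op_add : ∀ s t, op (s + t) = (op s).comp (op t)
  continuous_op : ∀ v : X, Continuous fun t => op t v

namespace C0Semigroup

variable {X : Type*} [NormedAddCommGroup X] [NormedSpace ℂ X]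

/-- `w` is the limit of the difference quotients `(T(h)v - v)/h` as `h → 0+`. -/
def HasDerivZero (T : C0Semigroup X) (v w : X) : Prop :=
  Tendsto (fun h : ℝ≥0 => (((h : ℝ) : ℂ))⁻¹ • (T.op h v - v)) (𝓝[>] 0) (𝓝 w)

theorem HasDerivZero.unique {T : C0Semigroup X} {v w w' : X}
    (h : T.HasDerivZero v w) (h' : T.HasDerivZero v w') : w = w' :=
  tendsto_nhds_unique h h'

theorem HasDerivZero.add {T : C0Semigroup X} {v w v' w' : X}
    (h : T.HasDerivZero v w) (h' : T.HasDerivZero v' w') :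
    T.HasDerivZero (v + v') (w + w') := by
  refine (Tendsto.add h h').congr fun a => ?_
  rw [← smul_add, map_add]
  congr 1
  abel

theorem HasDerivZero.smul {T : C0Semigroup X} {v w : X} (c : ℂ)
    (h : T.HasDerivZero v w) : T.HasDerivZero (c • v) (c • w) := by
  refine (Tendsto.const_smul h c).congr fun a => ?_
  rw [smul_comm, smul_sub, map_smul]

theorem HasDerivZero.zero (T : C0Semigroup X) : T.HasDerivZero 0 0 := by
  simp [HasDerivZero]

/-- The infinitesimal generator `A` of the semigroup, with its maximal domain: the vectors `v`
for which `(T(h)v - v)/h` converges as `h → 0+`; `A v` is the limit. -/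
def generator (T : C0Semigroup X) : X →ₗ.[ℂ] X where
  domain :=
    { carrier := {v | ∃ w, T.HasDerivZero v w}
      add_mem' := fun ⟨w, hw⟩ ⟨w', hw'⟩ => ⟨w + w', hw.add hw'⟩
      zero_mem' := ⟨0, HasDerivZero.zero T⟩
      smul_mem' := fun c _ ⟨w, hw⟩ => ⟨c • w, hw.smul c⟩ }
  toFun :=
    { toFun := fun v => Classical.choose v.2
      map_add' := fun v v' => (Classical.choose_spec (v + v').2).unique
        ((Classical.choose_spec v.2).add (Classical.choose_spec v'.2))
      map_smul' := fun c v => (Classical.choose_spec (c • v).2).unique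
        ((Classical.choose_spec v.2).smul c) }

end C0Semigroup

section Resolvent

variable {X : Type*} [NormedAddCommGroup X] [NormedSpace ℂ X]

/-- The bounded operator `R` is the two-sided inverse of `A - z I : D(A) → X`. -/
def IsResolventAt (A : X →ₗ.[ℂ] X) (z : ℂ) (R : X →L[ℂ] X) : Prop :=
  (∀ v : X, ∃ h : R v ∈ A.domain, A ⟨R v, h⟩ - z • R v = v) ∧
    ∀ v : A.domain, R (A v - z • (v : X)) = v

/-- The resolvent set `ρ(A)` of an unbounded operator. -/
def unboundedResolventSet (A : X →ₗ.[ℂ] X) : Set ℂ :=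
  {z | ∃ R : X →L[ℂ] X, IsResolventAt A z R}

/-- The spectrum `σ(A)` of an unbounded operator. -/
def unboundedSpectrum (A : X →ₗ.[ℂ] X) : Set ℂ := (unboundedResolventSet A)ᶜ

open Classical in
/-- The resolvent `R(z, A) = (A - z I)⁻¹` for `z ∈ ρ(A)` (and `0` for `z ∈ σ(A)`). -/
def unboundedResolvent (A : X →ₗ.[ℂ] X) (z : ℂ) : X →L[ℂ] X :=
  if h : ∃ R : X →L[ℂ] X, IsResolventAt A z R then Classical.choose h else 0

end Resolvent

section Convolution

variable {X : Type*} [NormedAddCommGroup X] [NormedSpace ℂ X]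

/-- Fourier transform `∫ f(t) exp(-i t l) dt` of a scalar function. -/
def scalarFourier (f : ℝ → ℂ) (l : ℝ) : ℂ :=
  ∫ t : ℝ, f t * Complex.exp (-(Complex.I * t * l))

/-- `(f * x)(t) = ∫ f(s) x(t - s) ds` for a scalar function `f`. -/
def scalarConv (f : ℝ → ℂ) (x : ℝ → X) (t : ℝ) : X := ∫ s : ℝ, f s • x (t - s)

/-- `(K * x)(t) = ∫ K(s) x(t - s) ds` for an operator-valued function `K`. -/
def opConv (K : ℝ → X →L[ℂ] X) (x : ℝ → X) (t : ℝ) : X := ∫ s : ℝ, K s (x (t - s))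

/-- `f` is an integrable majorant of the operator norm of `K`. -/
def IsMajorant (K : ℝ → X →L[ℂ] X) (f : ℝ → ℝ) : Prop :=
  Integrable f ∧ ∀ᵐ s : ℝ, ‖K s‖ ≤ f s

/-- Membership in `L¹ₛ(ℝ, B(X))`: strongly measurable along each vector, and with an
integrable majorant of the operator norm. -/
def MemL1s (K : ℝ → X →L[ℂ] X) : Prop :=
  (∀ v : X, AEStronglyMeasurable (fun s => K s v) volume) ∧ ∃ f : ℝ → ℝ, IsMajorant K f

/-- The norm of `L¹ₛ(ℝ, B(X))`: the infimum of the `L¹` norms of the majorants. -/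
def normL1s (K : ℝ → X →L[ℂ] X) : ℝ :=
  sInf {c | ∃ f : ℝ → ℝ, IsMajorant K f ∧ c = ∫ s : ℝ, ‖f s‖}

end Convolution

/-- A homogeneous Banach function space `F(ℝ, X)`. The Banach space is `E` (completeness is an
instance argument where the structure is used); `toAE` realizes its elements as classes of
functions `ℝ → X` up to equality almost everywhere. -/
structure HomogeneousSpace (X E : Type*) [NormedAddCommGroup X] [NormedSpace ℂ X]
    [NormedAddCommGroup E] [NormedSpace ℂ E] where
  /-- an element of the space, as a class of functions -/
  toAE : E →ₗ[ℂ] (ℝ →ₘ[volume] X)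
  toAE_injective : Function.Injective toAE
  /-- `E` is continuously embedded into the Stepanov space `S¹` -/
  stepanov_bound : ∃ C : ℝ, ∀ (x : E) (t : ℝ),
    ∫⁻ s in Set.Icc (0 : ℝ) 1, ‖toAE x (s + t)‖ₑ ≤ ENNReal.ofReal (C * ‖x‖)
  /-- translations act isometrically -/
  translation : ∀ (t : ℝ) (x : E), ∃ y : E,
    (∀ᵐ s : ℝ, toAE y s = toAE x (t + s)) ∧ ‖y‖ = ‖x‖
  /-- bounded operators act pointwise -/
  pointwise : ∀ (C : X →L[ℂ] X) (x : E), ∃ y : E,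
    (∀ᵐ s : ℝ, toAE y s = C (toAE x s)) ∧ ‖y‖ ≤ ‖C‖ * ‖x‖
  /-- `L¹ₛ(ℝ, B(X))` acts by convolution -/
  convolution : ∀ (K : ℝ → X →L[ℂ] X), MemL1s K → ∀ x : E, ∃ y : E,
    (∀ᵐ t : ℝ, toAE y t = opConv K (toAE x) t) ∧ ‖y‖ ≤ normL1s K * ‖x‖
  /-- the convolution action of `L¹(ℝ)` is non-degenerate -/
  nondegenerate : ∀ x : E,
    (∀ f : ℝ → ℂ, Integrable f → ∀ᵐ t : ℝ, scalarConv f (toAE x) t = 0) → x = 0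

namespace HomogeneousSpace

variable {X E : Type*} [NormedAddCommGroup X] [NormedSpace ℂ X]
  [NormedAddCommGroup E] [NormedSpace ℂ E]

/-- The Beurling spectrum of `x`: its complement consists of the `l` for which some
`f ∈ L¹(ℝ)` has nonzero Fourier transform at `l` and satisfies `f * x = 0`. -/
def beurlingSpectrum (F : HomogeneousSpace X E) (x : E) : Set ℝ :=
  {l | ∃ f : ℝ → ℂ, Integrable f ∧ scalarFourier f l ≠ 0 ∧
    ∀ᵐ t : ℝ, scalarConv f (F.toAE x) t = 0}ᶜ

/-- The spectral submodule `F(Δ)`: the elements with Beurling spectrum inside `Δ`. -/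
def spectralSubmodule (F : HomogeneousSpace X E) (Δ : Set ℝ) : Set E :=
  {x | F.beurlingSpectrum x ⊆ Δ}

/-- The graph of the parabolic operator `𝓛 = -d/dt + A`: `𝓛 x = y` when (the necessarily unique
and continuous representative `u` of) `x` satisfies
`u(t) = T(t-s) u(s) - ∫_s^t T(t-τ) y(τ) dτ` for all `s ≤ t`. -/
def ParabolicGraph (F : HomogeneousSpace X E) (T : C0Semigroup X) (x y : E) : Prop :=
  ∃ u : ℝ → X, (∀ᵐ t : ℝ, u t = F.toAE x t) ∧ ∀ s t : ℝ, s ≤ t →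
    u t = T.op (t - s).toNNReal (u s) -
      ∫ τ in s..t, T.op (t - τ).toNNReal (F.toAE y τ)

/-- The graph of the operator `𝓛` in the space `M ⊆ F(ℝ, X)`: both `x` and `𝓛 x` lie in `M`. -/
def ParabolicGraphIn (F : HomogeneousSpace X E) (T : C0Semigroup X) (M : Set E)
    (x y : E) : Prop :=
  x ∈ M ∧ y ∈ M ∧ F.ParabolicGraph T x y

end HomogeneousSpace

/-- `G` is the graph of a (partially defined, linear) operator in `M` that is invertible:
single-valued, with kernel `{0}` and with range `M`. -/
structure IsInvertibleGraph {E : Type*} [Zero E] (G : E → E → Prop) (M : Set E) : Prop where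
  single_valued : ∀ x y y', G x y → G x y' → y = y'
  ker_eq : {x | G x 0} = {0}
  range_eq : {y | ∃ x, G x y} = M

section Kernel

variable {X : Type*} [NormedAddCommGroup X] [NormedSpace ℂ X]

/-- A smooth compactly supported function `φ` that equals `1` in a neighbourhood of `Δ` and has
`i supp φ` inside the resolvent set of `A`. -/
structure IsSpectralCutoff (A : X →ₗ.[ℂ] X) (Δ : Set ℝ) (φ : ℝ → ℂ) : Prop where
  smooth : ContDiff ℝ ∞ φ
  compact_support : HasCompactSupport φ
  eq_one : ∃ U : Set ℝ, IsOpen U ∧ Δ ⊆ U ∧ ∀ l ∈ U, φ l = 1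
  support_resolvent : ∀ l ∈ tsupport φ, Complex.I * (l : ℂ) ∈ unboundedResolventSet A

/-- The inverse Fourier transform `(1/2π) ∫ φ(l) R(il, A) exp(i l t) dl`. -/
def resolventKernel (A : X →ₗ.[ℂ] X) (φ : ℝ → ℂ) (t : ℝ) : X →L[ℂ] X :=
  ((2 * Real.pi : ℝ) : ℂ)⁻¹ • ∫ l : ℝ,
    (φ l * Complex.exp (Complex.I * l * t)) • unboundedResolvent A (Complex.I * l)

end Kernel

end

/-! For `l` with `il` in the resolvent set, `exp(ilt) R(il, A) v` is a mild solution of `u' = A u -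
exp(ilt) v`. Multiplying by `φ(l)` and integrating over `l`, the kernel `F` solves `F' = A F - ψ` in
the mild sense, where `ψ` is the inverse Fourier transform of `φ`. Convolution with any `y` then
gives `𝓛(F * y) = ψ * y` (`parabolicGraph_resolventKernel`), with no spectral assumption on `y`.

The spectral assumption enters only through `ψ * y = y` for `y ∈ F(Δ)`, where `φ = 1` near `Δ`
(`sact_fourierSynthesis_eq_self`). Near a point `l₀` outside the spectrum of `x`, a kernel `f` with
`f * x = 0` and `f̂(l₀) ≠ 0` acts on components of nearby frequency almost as the scalar `f̂(l₀)`,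
so these components vanish. Compactness and smooth cutoffs extend this to every kernel whose
transform has compact support disjoint from the spectrum; band-limited approximate identities and
nondegeneracy finish the argument.

Surjectivity is now immediate. For injectivity, `F` commutes with the semigroup, so convolution with
`F` maps the graph of `𝓛` into itself (`ParabolicGraph.act`): if `𝓛 x = 0`, then `𝓛(F * x) = 0`,
while also `𝓛(F * x) = x`. Single-valuedness (`ParabolicGraph.unique`) gives `x = 0`; it comes from
Lebesgue differentiation and strong continuity at `0`. Single-valuedness also keeps `𝓛` inside
`F(Δ)`: if `f * x = 0`, then `f * 𝓛 x` is an image of `0` and so vanishes.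

Mild equations hold for all times, whereas convolutions of Stepanov functions converge in general
only almost everywhere. Two facts bridge this gap: Stepanov mild solutions are bounded, and `F`
decays quadratically. -/

/-! ### Semigroup bounds, joint continuity and differentiable orbits. -/

namespace C0Semigroup

variable {X : Type*} [NormedAddCommGroup X] [NormedSpace ℂ X]

theorem op_toNNReal_add (T : C0Semigroup X) {s t : ℝ} (hs : 0 ≤ s) (ht : 0 ≤ t) (v : X) :
    T.op (s + t).toNNReal v = T.op s.toNNReal (T.op t.toNNReal v) := by
  rw [Real.toNNReal_add hs ht, T.op_add, ContinuousLinearMap.comp_apply]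

theorem op_toNNReal_zero (T : C0Semigroup X) (v : X) : T.op (0 : ℝ).toNNReal v = v := by
  simp [T.op_zero]

theorem op_comm (T : C0Semigroup X) (s t : ℝ≥0) (v : X) :
    T.op s (T.op t v) = T.op t (T.op s v) := by
  rw [← ContinuousLinearMap.comp_apply, ← T.op_add, add_comm, T.op_add,
    ContinuousLinearMap.comp_apply]

/-- A `C₀`-semigroup is bounded on bounded time intervals. -/
theorem exists_norm_le (T : C0Semigroup X) [CompleteSpace X] (b : ℝ≥0) :
    ∃ M : ℝ, 0 ≤ M ∧ ∀ t ≤ b, ‖T.op t‖ ≤ M := by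
  have h : ∀ v : X, ∃ C, ∀ t : Set.Icc (0 : ℝ≥0) b, ‖T.op t v‖ ≤ C := fun v => by
    obtain ⟨C, hC⟩ := (isCompact_Icc (a := (0 : ℝ≥0)) (b := b)).exists_bound_of_continuousOn
      (T.continuous_op v).continuousOn
    exact ⟨C, fun t => hC t t.2⟩
  obtain ⟨M, hM⟩ := banach_steinhaus h
  exact ⟨M, (norm_nonneg _).trans (hM ⟨0, by simp⟩), fun t ht => hM ⟨t, zero_le, ht⟩⟩

/-- A `C₀`-semigroup is jointly continuous. -/
theorem continuous_uncurry_op (T : C0Semigroup X) [CompleteSpace X] :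
    Continuous fun p : ℝ≥0 × X => T.op p.1 p.2 := by
  refine continuous_iff_continuousAt.2 fun ⟨t₀, v₀⟩ => ?_
  obtain ⟨M, -, hM⟩ := T.exists_norm_le (t₀ + 1)
  -- Split `T(t)v = T(t)(v - v₀) + T(t)v₀`: the local uniform bound controls the first term, strong
  -- continuity the second.
  have h1 : Tendsto (fun p : ℝ≥0 × X => T.op p.1 (p.2 - v₀)) (𝓝 (t₀, v₀)) (𝓝 0) := by
    refine squeeze_zero_norm' (a := fun p : ℝ≥0 × X => M * ‖p.2 - v₀‖) ?_ ?_
    · have : ∀ᶠ p : ℝ≥0 × X in 𝓝 (t₀, v₀), p.1 < t₀ + 1 :=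
        continuous_fst.continuousAt.eventually_lt_const (by simp)
      filter_upwards [this] with p hp
      exact (T.op p.1).le_of_opNorm_le (hM _ hp.le) _
    · have : Continuous fun p : ℝ≥0 × X => M * ‖p.2 - v₀‖ := by fun_prop
      simpa using this.tendsto (t₀, v₀)
  have h2 : Tendsto (fun p : ℝ≥0 × X => T.op p.1 v₀) (𝓝 (t₀, v₀)) (𝓝 (T.op t₀ v₀)) :=
    ((T.continuous_op v₀).comp continuous_fst).tendsto (t₀, v₀)
  have h3 := h1.add h2
  simpa [ContinuousAt] using h3

theorem continuous_op_toNNReal (T : C0Semigroup X) (v : X) :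
    Continuous fun t : ℝ => T.op t.toNNReal v :=
  (T.continuous_op v).comp continuous_real_toNNReal

theorem hasDerivZero_generator (T : C0Semigroup X) (w : T.generator.domain) :
    T.HasDerivZero (w : X) (T.generator w) :=
  Classical.choose_spec w.2

theorem mem_domain_of_hasDerivZero {T : C0Semigroup X} {v w : X} (h : T.HasDerivZero v w) :
    ∃ hv : v ∈ T.generator.domain, T.generator ⟨v, hv⟩ = w :=
  ⟨⟨w, h⟩, (T.hasDerivZero_generator ⟨v, ⟨w, h⟩⟩).unique h⟩

theorem HasDerivZero.map_op {T : C0Semigroup X} {v w : X} (h : T.HasDerivZero v w) (t : ℝ≥0) :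
    T.HasDerivZero (T.op t v) (T.op t w) := by
  refine (((T.op t).continuous.tendsto w).comp h).congr fun a => ?_
  simp only [Function.comp_apply, map_smul, map_sub]
  rw [T.op_comm]

/-- The orbit of a vector of the domain of the generator is differentiable from the right. -/
theorem HasDerivZero.hasDerivWithinAt {T : C0Semigroup X} {v w : X} (h : T.HasDerivZero v w)
    {t : ℝ} (ht : 0 ≤ t) :
    HasDerivWithinAt (fun r : ℝ => T.op r.toNNReal v) (T.op t.toNNReal w) (Set.Ioi t) t := by
  rw [hasDerivWithinAt_iff_tendsto_slope' (by simp)]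
  have hm : Tendsto (fun r : ℝ => (r - t).toNNReal) (𝓝[>] t) (𝓝[>] 0) := by
    refine tendsto_nhdsWithin_iff.2 ⟨?_, ?_⟩
    · have : Continuous fun r : ℝ => (r - t).toNNReal := by fun_prop
      simpa using this.tendsto t |>.mono_left nhdsWithin_le_nhds
    · filter_upwards [self_mem_nhdsWithin] with r hr
      simpa using hr
  -- The right difference quotient of the orbit at `t` is the quotient at `0` of the vector `T(t)v`,
  -- with increment `r - t`.
  refine ((h.map_op t.toNNReal).comp hm).congr' ?_
  filter_upwards [self_mem_nhdsWithin] with r hr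
  have hr' : 0 ≤ r - t := sub_nonneg.2 (le_of_lt hr)
  simp only [Function.comp_apply, slope_def_module]
  rw [← T.op_toNNReal_add hr' ht, sub_add_cancel, Real.coe_toNNReal _ hr', ← Complex.ofReal_inv,
    Complex.coe_smul]

end C0Semigroup

/-! ### Openness of the resolvent set and smoothness of the resolvent. -/

section Resolvent

variable {X : Type*} [NormedAddCommGroup X] [NormedSpace ℂ X]

theorem IsResolventAt.unique {A : X →ₗ.[ℂ] X} {z : ℂ} {R R' : X →L[ℂ] X}
    (h : IsResolventAt A z R) (h' : IsResolventAt A z R') : R = R' := by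
  ext v
  obtain ⟨hv, e⟩ := h.1 v
  have := h'.2 ⟨R v, hv⟩
  rw [e] at this
  exact this.symm

theorem isResolventAt_unboundedResolvent {A : X →ₗ.[ℂ] X} {z : ℂ}
    (hz : z ∈ unboundedResolventSet A) : IsResolventAt A z (unboundedResolvent A z) := by
  have hz' : ∃ R : X →L[ℂ] X, IsResolventAt A z R := hz
  rw [unboundedResolvent, dif_pos hz']
  exact Classical.choose_spec hz'

/-- The resolvent near a point of the resolvent set, as a perturbation of its value there. -/
theorem IsResolventAt.perturb {A : X →ₗ.[ℂ] X} {z : ℂ} {R : X →L[ℂ] X}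
    (h : IsResolventAt A z R) {w : ℂ} (hu : IsUnit (1 - (w - z) • R)) :
    IsResolventAt A w (R * Ring.inverse (1 - (w - z) • R)) := by
  have hc : Commute R (1 - (w - z) • R) :=
    (Commute.one_right R).sub_right ((Commute.refl R).smul_right _)
  obtain ⟨u, hu⟩ := hu
  rw [← hu] at hc ⊢
  rw [Ring.inverse_unit]
  constructor
  · intro v
    set y := (↑u⁻¹ : X →L[ℂ] X) v with hy
    -- Since `(A - z)Ry = y`, one gets `(A - w)Ry = y - (w - z)Ry`, which is `v`.
    have hyv : (1 - (w - z) • R) y = v := by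
      rw [hy, ← hu, ← mul_apply_eq_comp, Units.mul_inv, one_apply_eq_self]
    obtain ⟨hd, e⟩ := h.1 y
    refine ⟨hd, ?_⟩
    change A ⟨R y, hd⟩ - w • R y = v
    rw [← hyv]
    simp only [sub_apply, one_apply_eq_self,
      smul_apply, sub_smul]
    nth_rewrite 3 [← e]
    abel
  · intro v
    have hc' : R * (↑u⁻¹ : X →L[ℂ] X) = ↑u⁻¹ * R := (hc.units_inv_right).eq
    rw [hc', mul_apply_eq_comp]
    have : R (A v - w • (v : X)) = (u : X →L[ℂ] X) v := by
      have h2 := h.2 v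
      rw [hu, sub_apply, one_apply_eq_self,
        smul_apply]
      have : A v - w • (v : X) = (A v - z • (v : X)) - (w - z) • (v : X) := by
        rw [sub_smul]; abel
      rw [this, map_sub, h2, map_smul]
    rw [this, ← mul_apply_eq_comp, Units.inv_mul, one_apply_eq_self]

variable [CompleteSpace X]

theorem eventually_isUnit_one_sub_smul (z : ℂ) (R : X →L[ℂ] X) :
    ∀ᶠ w in 𝓝 z, IsUnit (1 - (w - z) • R) := by
  have hc : Continuous fun w : ℂ => (1 : X →L[ℂ] X) - (w - z) • R := by fun_prop
  refine hc.continuousAt.eventually (Units.isOpen.mem_nhds ?_)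
  simp

theorem isOpen_unboundedResolventSet (A : X →ₗ.[ℂ] X) : IsOpen (unboundedResolventSet A) := by
  refine isOpen_iff_mem_nhds.2 fun z hz => ?_
  obtain ⟨R, hR⟩ := hz
  filter_upwards [eventually_isUnit_one_sub_smul z R] with w hw
  exact ⟨_, hR.perturb hw⟩

/-- By uniqueness, near `z` the resolvent is given by the formula of `IsResolventAt.perturb`, and
inversion is smooth at units. -/
theorem contDiffAt_unboundedResolvent {A : X →ₗ.[ℂ] X} {z : ℂ}
    (hz : z ∈ unboundedResolventSet A) :
    ContDiffAt ℂ ∞ (fun w => unboundedResolvent A w) z := by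
  obtain ⟨R, hR⟩ := hz
  have h1 : ContDiffAt ℂ ∞ (fun w : ℂ => R * Ring.inverse (1 - (w - z) • R)) z := by
    have h2 : ContDiffAt ℂ ∞ (fun w : ℂ => (1 : X →L[ℂ] X) - (w - z) • R) z := by fun_prop
    have h3 : ContDiffAt ℂ ∞ Ring.inverse ((1 : X →L[ℂ] X) - (z - z) • R) := by
      simpa using contDiffAt_ringInverse ℂ (1 : (X →L[ℂ] X)ˣ)
    exact contDiffAt_const.mul (ContDiffAt.comp z (g := Ring.inverse) h3 h2)
  refine h1.congr_of_eventuallyEq ?_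
  filter_upwards [eventually_isUnit_one_sub_smul z R] with w hw
  have := hR.perturb hw
  exact (isResolventAt_unboundedResolvent ⟨_, this⟩).unique this

end Resolvent

/-! ### The resolvent of the generator along the semigroup. -/

namespace C0Semigroup

variable {X : Type*} [NormedAddCommGroup X] [NormedSpace ℂ X]

/-- The resolvent of the generator commutes with the semigroup. -/
theorem resolvent_op_comm {T : C0Semigroup X} {z : ℂ} {R : X →L[ℂ] X}
    (hR : IsResolventAt T.generator z R) (t : ℝ≥0) (v : X) :
    R (T.op t v) = T.op t (R v) := by
  obtain ⟨hd, e⟩ := hR.1 v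
  obtain ⟨hd', e'⟩ := mem_domain_of_hasDerivZero ((T.hasDerivZero_generator ⟨R v, hd⟩).map_op t)
  have := hR.2 ⟨_, hd'⟩
  rw [e'] at this
  simp only at this
  rwa [← map_smul, ← map_sub, e] at this

/-- The variation of constants formula for the exponential solutions `exp(z t) R(z, A) v`. -/
theorem exp_smul_resolvent {T : C0Semigroup X} [CompleteSpace X] {z : ℂ} {R : X →L[ℂ] X}
    (hR : IsResolventAt T.generator z R) {s t : ℝ} (hst : s ≤ t) (v : X) :
    Complex.exp (z * t) • R v = T.op (t - s).toNNReal (Complex.exp (z * s) • R v) -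
      ∫ τ in s..t, Complex.exp (z * τ) • T.op (t - τ).toNNReal v := by
  obtain ⟨hd, e⟩ := hR.1 v
  have hw := T.hasDerivZero_generator ⟨R v, hd⟩
  set w := T.generator ⟨R v, hd⟩
  -- With `r = t - τ`, the derivative is `exp(z(t - r)) T(r)(A - z)Rv`, and `(A - z)Rv = v`. Right
  -- derivatives suffice for the fundamental theorem of calculus.
  have hderiv : ∀ r : ℝ, 0 ≤ r → HasDerivWithinAt
      (fun r : ℝ => Complex.exp (z * (t - r : ℝ)) • T.op r.toNNReal (R v))
      (Complex.exp (z * (t - r : ℝ)) • T.op r.toNNReal v) (Set.Ioi r) r := fun r hr => by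
    have h1 : HasDerivAt (fun r : ℝ => Complex.exp (z * (t - r : ℝ)))
        (Complex.exp (z * (t - r : ℝ)) * -z) r := by
      have : HasDerivAt (fun r : ℝ => z * (t - r : ℝ)) (-z) r := by
        have := (((hasDerivAt_id r).const_sub t).ofReal_comp).const_mul z
        simpa using this
      exact this.cexp
    have h2 := h1.hasDerivWithinAt (s := Set.Ioi r) |>.smul (hw.hasDerivWithinAt hr)
    refine h2.congr_deriv ?_
    have he : T.op r.toNNReal v = T.op r.toNNReal w - z • T.op r.toNNReal (R v) := by
      rw [← map_smul, ← map_sub, e]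
    rw [he, smul_sub, mul_smul, neg_smul, smul_neg]
    abel
  have hF := intervalIntegral.integral_eq_sub_of_hasDeriv_right (a := 0) (b := t - s)
    (f := fun r : ℝ => Complex.exp (z * (t - r : ℝ)) • T.op r.toNNReal (R v))
    (f' := fun r : ℝ => Complex.exp (z * (t - r : ℝ)) • T.op r.toNNReal v)
    (Continuous.continuousOn (by have := T.continuous_op_toNNReal (R v); fun_prop))
    (fun r hr => hderiv r (by simpa [sub_nonneg.2 hst] using hr.1.le))
    (Continuous.intervalIntegrable (by have := T.continuous_op_toNNReal v; fun_prop) _ _)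
  have hs : ∫ τ in s..t, Complex.exp (z * τ) • T.op (t - τ).toNNReal v =
      ∫ r in (0 : ℝ)..(t - s), Complex.exp (z * (t - r : ℝ)) • T.op r.toNNReal v := by
    have := intervalIntegral.integral_comp_sub_left (a := s) (b := t)
      (fun r : ℝ => Complex.exp (z * (t - r : ℝ)) • T.op r.toNNReal v) t
    simpa using this
  rw [hs, hF, map_smul, sub_sub_cancel, op_toNNReal_zero]
  simp

end C0Semigroup

/-! ### Inverse Fourier transforms of smooth compactly supported functions. -/

section Synthesis

variable {B : Type*} [NormedAddCommGroup B] [NormedSpace ℂ B]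

/-- The inverse Fourier transform `(1/2π) ∫ Φ(l) exp(i l t) dl`. -/
noncomputable def fourierSynthesis (Φ : ℝ → B) (t : ℝ) : B :=
  ((2 * Real.pi : ℝ) : ℂ)⁻¹ • ∫ l : ℝ, Complex.exp (Complex.I * l * t) • Φ l

theorem norm_exp_I_mul (a b : ℝ) : ‖Complex.exp (Complex.I * a * b)‖ = 1 := by
  rw [show Complex.I * a * b = ((a * b : ℝ) : ℂ) * Complex.I by push_cast; ring,
    Complex.norm_exp_ofReal_mul_I]

theorem norm_exp_neg_I_mul (a b : ℝ) : ‖Complex.exp (-(Complex.I * a * b))‖ = 1 := by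
  rw [Complex.exp_neg, norm_inv, norm_exp_I_mul, inv_one]

theorem fourierSynthesis_eq (Φ : ℝ → B) (t : ℝ) :
    fourierSynthesis Φ t =
      ((2 * Real.pi : ℝ) : ℂ)⁻¹ • FourierTransformInv.fourierInv Φ (t / (2 * Real.pi)) := by
  rw [fourierSynthesis, Real.fourierInv_eq']
  congr 2
  ext l
  congr 2
  simp only [RCLike.inner_apply, conj_trivial]
  push_cast
  have := Real.pi_ne_zero
  field_simp

theorem HasCompactSupport.fourierSynthesis_eq {Φ : ℝ → B} (h : HasCompactSupport Φ)
    (h' : ContDiff ℝ ∞ Φ) (t : ℝ) :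
    fourierSynthesis Φ t = ((2 * Real.pi : ℝ) : ℂ)⁻¹ •
      (FourierTransformInv.fourierInv (h.toSchwartzMap h')) (t / (2 * Real.pi)) := by
  rw [_root_.fourierSynthesis_eq, SchwartzMap.fourierInv_coe]
  rfl

theorem HasCompactSupport.continuous_fourierSynthesis {Φ : ℝ → B} (h : HasCompactSupport Φ)
    (h' : ContDiff ℝ ∞ Φ) : Continuous (fourierSynthesis Φ) := by
  rw [funext (h.fourierSynthesis_eq h')]
  fun_prop

/-- Up to rescaling, the synthesis is a Schwartz function; the seminorms of decay orders `0` and `2`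
combine to the weight `1 + t²`. The factor `(2π)²` undoes the rescaling `t / (2π)`. -/
theorem HasCompactSupport.exists_norm_fourierSynthesis_le {Φ : ℝ → B} (h : HasCompactSupport Φ)
    (h' : ContDiff ℝ ∞ Φ) :
    ∃ C : ℝ, 0 ≤ C ∧ ∀ t, ‖fourierSynthesis Φ t‖ ≤ C * (1 + t ^ 2)⁻¹ := by
  set g := FourierTransformInv.fourierInv (h.toSchwartzMap h')
  obtain ⟨C₀, h₀, hC₀⟩ := g.decay 0 0
  obtain ⟨C₂, h₂, hC₂⟩ := g.decay 2 0
  have hπ : 0 < 2 * Real.pi := by positivity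
  have hπ1 : 1 ≤ 2 * Real.pi := by linarith [Real.pi_gt_three]
  refine ⟨C₀ + (2 * Real.pi) ^ 2 * C₂, by positivity, fun t => ?_⟩
  rw [h.fourierSynthesis_eq h', norm_smul]
  have e0 := hC₀ (t / (2 * Real.pi))
  have e2 := hC₂ (t / (2 * Real.pi))
  simp only [pow_zero, one_mul, norm_iteratedFDeriv_zero, Real.norm_eq_abs, sq_abs] at e0 e2
  rw [div_pow, div_mul_eq_mul_div, div_le_iff₀ (by positivity)] at e2
  have hn : ‖(((2 * Real.pi : ℝ) : ℂ))⁻¹‖ ≤ 1 := by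
    rw [norm_inv, Complex.norm_real, Real.norm_of_nonneg hπ.le]
    exact inv_le_one_of_one_le₀ hπ1
  refine (mul_le_of_le_one_left (norm_nonneg _) hn).trans ?_
  rw [← div_eq_mul_inv, le_div_iff₀ (by positivity)]
  linarith

theorem HasCompactSupport.integrable_fourierSynthesis {Φ : ℝ → B} (h : HasCompactSupport Φ)
    (h' : ContDiff ℝ ∞ Φ) : Integrable (fourierSynthesis Φ) := by
  obtain ⟨C, -, hC⟩ := h.exists_norm_fourierSynthesis_le h'
  exact (integrable_inv_one_add_sq.const_mul C).mono'
    (h.continuous_fourierSynthesis h').aestronglyMeasurable (ae_of_all _ hC)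

/-- Fourier inversion. -/
theorem scalarFourier_fourierSynthesis {χ : ℝ → ℂ} (h : HasCompactSupport χ)
    (h' : ContDiff ℝ ∞ χ) (l : ℝ) : scalarFourier (fourierSynthesis χ) l = χ l := by
  have hπ : 0 < 2 * Real.pi := by positivity
  have e : χ l = FourierTransform.fourier
      (FourierTransformInv.fourierInv (h.toSchwartzMap h')) l := by
    rw [FourierTransform.fourier_fourierInv_eq]; rfl
  rw [e, SchwartzMap.fourier_coe, Real.fourier_real_eq_integral_exp_smul, scalarFourier]
  have := Measure.integral_comp_div (fun s : ℝ => Complex.exp (↑(-2 * Real.pi * s * l) *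
    Complex.I) • FourierTransformInv.fourierInv (h.toSchwartzMap h') s) (2 * Real.pi)
  rw [abs_of_pos hπ, ← inv_smul_eq_iff₀ hπ.ne'] at this
  rw [← this, ← integral_smul]
  congr 1
  ext t
  rw [h.fourierSynthesis_eq h', Complex.real_smul, smul_eq_mul, smul_eq_mul, Complex.ofReal_inv]
  rw [mul_assoc, mul_comm (Complex.exp _)]
  congr 3
  push_cast
  have := Real.pi_ne_zero
  field_simp

theorem MeasureTheory.Integrable.exp_smul {Φ : ℝ → B} (h : Integrable Φ) (t : ℝ) :
    Integrable fun l : ℝ => Complex.exp (Complex.I * l * t) • Φ l :=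
  h.mono ((Continuous.aestronglyMeasurable (by fun_prop)).smul h.1)
    (ae_of_all _ fun l => by rw [norm_smul, norm_exp_I_mul, one_mul])

theorem fourierSynthesis_sub {Φ Ψ : ℝ → B} (hΦ : Integrable Φ) (hΨ : Integrable Ψ) (t : ℝ) :
    fourierSynthesis (fun l => Φ l - Ψ l) t = fourierSynthesis Φ t - fourierSynthesis Ψ t := by
  simp only [fourierSynthesis, smul_sub]
  rw [integral_sub (hΦ.exp_smul t) (hΨ.exp_smul t), smul_sub]

theorem fourierSynthesis_comp_mul_left (Φ : ℝ → B) {a : ℝ} (ha : 0 < a) (t : ℝ) :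
    fourierSynthesis (fun l => Φ (a * l)) t = a⁻¹ • fourierSynthesis Φ (a⁻¹ * t) := by
  have := Measure.integral_comp_mul_left
    (fun l : ℝ => Complex.exp (Complex.I * l * (a⁻¹ * t : ℝ)) • Φ l) a
  rw [abs_of_pos (inv_pos.2 ha)] at this
  rw [fourierSynthesis, fourierSynthesis, smul_comm, ← this]
  congr 3
  ext l
  congr 2
  push_cast
  have : (a : ℂ) ≠ 0 := by exact_mod_cast ha.ne'
  field_simp

theorem fourierSynthesis_comp_sub_right (Φ : ℝ → B) (c t : ℝ) :
    fourierSynthesis (fun l => Φ (l - c)) t =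
      Complex.exp (Complex.I * c * t) • fourierSynthesis Φ t := by
  have := integral_sub_right_eq_self
    (fun l : ℝ => Complex.exp (Complex.I * (l + c : ℝ) * t) • Φ l) (μ := volume) c
  simp only [sub_add_cancel] at this
  rw [fourierSynthesis, fourierSynthesis, smul_comm, this]
  congr 1
  rw [← integral_smul]
  congr 1 with l
  rw [smul_smul, ← Complex.exp_add]
  congr 2
  push_cast
  ring

/-- Convolution becomes multiplication on the Fourier side. -/
theorem scalarConv_fourierSynthesis {f χ : ℝ → ℂ} (hf : Integrable f) (hχ : Integrable χ)
    (t : ℝ) : scalarConv f (fourierSynthesis χ) t =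
      fourierSynthesis (fun l => scalarFourier f l * χ l) t := by
  have hint : Integrable (Function.uncurry fun s l : ℝ =>
      f s * (Complex.exp (Complex.I * l * (t - s : ℝ)) * χ l)) (volume.prod volume) := by
    refine (hf.mul_prod hχ).mono ?_ (ae_of_all _ fun p => ?_)
    · refine hf.1.comp_fst.mul (AEStronglyMeasurable.mul ?_ hχ.1.comp_snd)
      exact Continuous.aestronglyMeasurable (by fun_prop)
    · simp only [Function.uncurry, norm_mul, norm_exp_I_mul, one_mul, le_refl]
  simp only [scalarConv, fourierSynthesis, smul_eq_mul, mul_left_comm (f _), integral_const_mul]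
  congr 1
  simp_rw [← integral_const_mul]
  rw [integral_integral_swap hint]
  congr 1
  ext l
  rw [scalarFourier, ← integral_mul_const, ← integral_const_mul]
  congr 1
  ext s
  have : Complex.exp (Complex.I * l * (t - s : ℝ)) =
      Complex.exp (Complex.I * l * t) * Complex.exp (-(Complex.I * s * l)) := by
    rw [← Complex.exp_add]; congr 1; push_cast; ring
  rw [this]
  ring

end Synthesis

/-! ### Continuity of translation in the mean. -/

section Modulus

theorem lintegral_comp_mul_left (g : ℝ → ℝ≥0∞) {a : ℝ} (ha : 0 < a) :
    ∫⁻ x, g (a * x) = ENNReal.ofReal a⁻¹ * ∫⁻ x, g x := by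
  have h := (Homeomorph.mulLeft₀ a ha.ne').measurableEmbedding.lintegral_map g (μ := volume)
  simp only [Homeomorph.coe_mulLeft₀] at h
  rw [← h, Real.map_volume_mul_left ha.ne', lintegral_smul_measure, abs_of_pos (inv_pos.2 ha),
    smul_eq_mul]

/-- The modulus of continuity in the mean. -/
noncomputable def meanModulus (g : ℝ → ℂ) (h : ℝ) : ℝ≥0∞ := ∫⁻ t, ‖g (t - h) - g t‖ₑ

/-- The modulus is the `L¹` distance from `g` to its translate, and translation acts continuously on
`L¹`. -/
theorem MeasureTheory.Integrable.continuous_meanModulus {g : ℝ → ℂ} (hg : Integrable g) :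
    Continuous (meanModulus g) := by
  let c : ℝ → C(ℝ, ℝ) := fun h => ⟨fun t => t - h, by fun_prop⟩
  have hc : Continuous c := ContinuousMap.continuous_of_continuous_uncurry _ (by
    change Continuous fun p : ℝ × ℝ => p.2 - p.1
    fun_prop)
  have hm : ∀ h, MeasurePreserving (c h) volume volume := fun h => measurePreserving_sub_right _ h
  have hcont := (continuous_const (y := hg.toL1 g)).compMeasurePreservingLp hc hm ENNReal.one_ne_top
  have : meanModulus g = fun h => edist
      (Lp.compMeasurePreserving (c h) (hm h) (hg.toL1 g)) (hg.toL1 g) := by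
    ext h
    have e : Lp.compMeasurePreserving (c h) (hm h) (hg.toL1 g) =
        ((hm h).integrable_comp_of_integrable hg).toL1 (g ∘ c h) := by
      ext1
      filter_upwards [Lp.coeFn_compMeasurePreserving (hg.toL1 g) (hm h),
        Integrable.coeFn_toL1 ((hm h).integrable_comp_of_integrable hg),
        (hm h).quasiMeasurePreserving.ae hg.coeFn_toL1] with t h1 h2 h3
      rw [h1, h2]
      exact h3
    rw [e, Integrable.edist_toL1_toL1, meanModulus]
    simp only [edist_eq_enorm_sub]
    rfl
  rw [this]
  exact hcont.edist continuous_const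

theorem meanModulus_zero (g : ℝ → ℂ) : meanModulus g 0 = 0 := by simp [meanModulus]

theorem meanModulus_le {g : ℝ → ℂ} (hg : Integrable g) (h : ℝ) :
    meanModulus g h ≤ 2 * ∫⁻ t, ‖g t‖ₑ := by
  calc meanModulus g h ≤ ∫⁻ t, (‖g (t - h)‖ₑ + ‖g t‖ₑ) := lintegral_mono fun t => enorm_sub_le
    _ = 2 * ∫⁻ t, ‖g t‖ₑ := by
      rw [lintegral_add_right' _ hg.1.enorm, lintegral_sub_right_eq_self (fun t => ‖g t‖ₑ) h,
        two_mul]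

/-- An `L¹`-normalised dilation by a small `a` makes a kernel nearly invariant under a fixed
translation. -/
theorem meanModulus_dilation (g : ℝ → ℂ) {a : ℝ} (ha : 0 < a) (h : ℝ) :
    meanModulus (fun t => a • g (a * t)) h = meanModulus g (a * h) := by
  simp only [meanModulus, ← smul_sub, enorm_smul, mul_sub a]
  rw [lintegral_const_mul' _ _ enorm_ne_top,
    lintegral_comp_mul_left (fun t => ‖g (t - a * h) - g t‖ₑ) ha, ← mul_assoc,
    Real.enorm_of_nonneg ha.le, ← ENNReal.ofReal_mul ha.le, mul_inv_cancel₀ ha.ne',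
    ENNReal.ofReal_one, one_mul]

theorem tendsto_lintegral_mul_meanModulus {f g : ℝ → ℂ} (hf : Integrable f) (hg : Integrable g)
    {a : ℕ → ℝ} (ha : Tendsto a atTop (𝓝 0)) :
    Tendsto (fun n => ∫⁻ s, ‖f s‖ₑ * meanModulus g (a n * s)) atTop (𝓝 0) := by
  have hm := hg.continuous_meanModulus
  have : ∫⁻ _ : ℝ, (0 : ℝ≥0∞) = 0 := lintegral_zero
  rw [← this]
  refine tendsto_lintegral_of_dominated_convergence' (fun s => ‖f s‖ₑ * (2 * ∫⁻ t, ‖g t‖ₑ))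
    (fun n => hf.1.enorm.mul (hm.comp (by fun_prop)).aemeasurable)
    (fun n => ae_of_all _ fun s => mul_le_mul_right (meanModulus_le hg _) _) ?_
    (ae_of_all _ fun s => ?_)
  · rw [lintegral_mul_const'' _ hf.1.enorm]
    exact ENNReal.mul_ne_top hf.2.ne (ENNReal.mul_ne_top (by simp) hg.2.ne)
  · have h1 : Tendsto (fun n => meanModulus g (a n * s)) atTop (𝓝 0) := by
      have := (hm.tendsto 0).comp (by simpa using ha.mul_const s :
        Tendsto (fun n => a n * s) atTop (𝓝 0))
      rwa [meanModulus_zero] at this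
    have := ENNReal.Tendsto.const_mul h1 (Or.inr (enorm_ne_top (x := f s)))
    simpa using this

theorem lintegral_enorm_integral_mul_sub_le {k g : ℝ → ℂ} (hk : Integrable k)
    (hg : Integrable g) :
    ∫⁻ t, ‖∫ s, k s * (g (t - s) - g t)‖ₑ ≤ ∫⁻ s, ‖k s‖ₑ * meanModulus g s := by
  have hm : AEStronglyMeasurable (fun p : ℝ × ℝ => k p.2 * (g (p.1 - p.2) - g p.1))
      (volume.prod volume) :=
    hk.1.comp_snd.mul ((hg.1.comp_quasiMeasurePreserving
      (quasiMeasurePreserving_sub_of_right_invariant volume volume)).sub hg.1.comp_fst)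
  calc ∫⁻ t, ‖∫ s, k s * (g (t - s) - g t)‖ₑ
      ≤ ∫⁻ t, ∫⁻ s, ‖k s * (g (t - s) - g t)‖ₑ :=
        lintegral_mono fun t => enorm_integral_le_lintegral_enorm _
    _ = ∫⁻ s, ∫⁻ t, ‖k s * (g (t - s) - g t)‖ₑ := lintegral_lintegral_swap hm.enorm
    _ = ∫⁻ s, ‖k s‖ₑ * meanModulus g s := by
      simp only [enorm_mul]
      simp_rw [lintegral_const_mul' _ _ (enorm_ne_top (x := k _))]
      rfl

end Modulus

/-! ### Stepanov functions and convergence of convolutions. -/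

section Stepanov

variable {X : Type*} [NormedAddCommGroup X]

/-- A strongly measurable function with finite Stepanov norm. -/
structure IsStepanov (x : ℝ → X) : Prop where
  stronglyMeasurable : StronglyMeasurable x
  bound : ∃ C : ℝ≥0∞, C ≠ ⊤ ∧ ∀ t : ℝ, ∫⁻ s in Set.Icc (0 : ℝ) 1, ‖x (s + t)‖ₑ ≤ C

theorem IsStepanov.exists_lintegral_Icc_le {x : ℝ → X} (hx : IsStepanov x) (a b : ℝ) :
    ∃ D : ℝ≥0∞, D ≠ ⊤ ∧ ∀ r : ℝ, ∫⁻ τ in Set.Icc a b, ‖x (τ - r)‖ₑ ≤ D := by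
  obtain ⟨C, hC, h⟩ := hx.bound
  obtain ⟨N, hN⟩ := exists_nat_gt (b - a)
  refine ⟨N * C, ENNReal.mul_ne_top (by simp) hC, fun r => ?_⟩
  -- `N` unit intervals starting at `a` cover `[a, b]`, and each contributes at most the Stepanov
  -- bound.
  have hsub : Set.Icc a b ⊆ ⋃ i : Fin N, (fun τ : ℝ => τ - (a + (i : ℕ))) ⁻¹' Set.Icc 0 1 := by
    intro τ hτ
    have h0 : 0 ≤ τ - a := sub_nonneg.2 hτ.1
    have h1 := Nat.floor_le h0
    have h2 := Nat.lt_floor_add_one (τ - a)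
    simp only [Set.mem_iUnion, Set.mem_preimage, Set.mem_Icc]
    exact ⟨⟨⌊τ - a⌋₊, (Nat.floor_lt h0).2 (by linarith [hτ.2])⟩, by linarith, by linarith⟩
  calc ∫⁻ τ in Set.Icc a b, ‖x (τ - r)‖ₑ
      ≤ ∫⁻ τ in ⋃ i : Fin N, (fun τ : ℝ => τ - (a + (i : ℕ))) ⁻¹' Set.Icc 0 1,
          ‖x (τ - r)‖ₑ := lintegral_mono_set hsub
    _ ≤ ∑ i : Fin N, ∫⁻ τ in (fun τ : ℝ => τ - (a + (i : ℕ))) ⁻¹' Set.Icc 0 1,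
          ‖x (τ - r)‖ₑ := (lintegral_iUnion_le _ _).trans_eq (tsum_fintype _)
    _ ≤ ∑ i : Fin N, C := Finset.sum_le_sum fun i _ => by
        have := (measurePreserving_sub_right volume (a + (i : ℕ) : ℝ)).setLIntegral_comp_preimage_emb
          (measurableEmbedding_subRight _) (fun s => ‖x (s + (a + (i : ℕ) - r))‖ₑ) (Set.Icc 0 1)
        refine le_trans (le_of_eq ?_) (h (a + (i : ℕ) - r))
        rw [← this]
        congr with τ
        congr 2
        ring
    _ = N * C := by simp

/-- The constant `3` comes from `(s + a)² ≤ 2s² + 2a²` and `a ≤ 1`. -/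
theorem inv_one_add_sq_le (s : ℝ) {a : ℝ} (h0 : 0 ≤ a) (h1 : a ≤ 1) :
    (1 + s ^ 2)⁻¹ ≤ 3 * (1 + (s + a) ^ 2)⁻¹ := by
  rw [← div_eq_mul_inv, inv_le_comm₀ (by positivity) (by positivity), inv_div,
    div_le_iff₀ (by positivity)]
  nlinarith [sq_nonneg (s - a), sq_nonneg s]

/-- Stepanov functions are uniformly integrable against translates of `1 / (1 + s²)`. -/
theorem IsStepanov.exists_lintegral_inv_one_add_sq_le {x : ℝ → X} (hx : IsStepanov x) :
    ∃ D : ℝ≥0∞, D ≠ ⊤ ∧ ∀ t : ℝ,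
      ∫⁻ s, ENNReal.ofReal (1 + s ^ 2)⁻¹ * ‖x (t - s)‖ₑ ≤ D := by
  obtain ⟨C, hC, h⟩ := hx.bound
  set w : ℝ → ℝ≥0∞ := fun s => ENNReal.ofReal (1 + s ^ 2)⁻¹ with hw
  have hwm : Measurable w := by fun_prop
  have hx' := hx.stronglyMeasurable
  have hwi : ∫⁻ s, w s ≠ ⊤ := integrable_inv_one_add_sq.lintegral_lt_top.ne
  refine ⟨3 * ((∫⁻ s, w s) * C), by finiteness, fun t => ?_⟩
  -- The weight is dominated by its average over a unit window. Tonelli and a translation transfer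
  -- this average to `x`, where the Stepanov bound applies.
  have hle : ∀ s, w s ≤ ∫⁻ a in Set.Icc (0 : ℝ) 1, 3 * w (s + a) := fun s => by
    calc w s = ∫⁻ a in Set.Icc (0 : ℝ) 1, w s := by simp
      _ ≤ _ := setLIntegral_mono (by fun_prop) fun a ha => by
        have := ENNReal.ofReal_le_ofReal (inv_one_add_sq_le s ha.1 ha.2)
        rwa [ENNReal.ofReal_mul (by norm_num), ENNReal.ofReal_ofNat] at this
  calc ∫⁻ s, w s * ‖x (t - s)‖ₑ
      ≤ ∫⁻ s, (∫⁻ a in Set.Icc (0 : ℝ) 1, 3 * w (s + a)) * ‖x (t - s)‖ₑ :=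
        lintegral_mono fun s => mul_le_mul_left (hle s) _
    _ = ∫⁻ s, ∫⁻ a in Set.Icc (0 : ℝ) 1, 3 * w (s + a) * ‖x (t - s)‖ₑ := by
        congr with s
        rw [lintegral_mul_const _ (by fun_prop)]
    _ = ∫⁻ a in Set.Icc (0 : ℝ) 1, ∫⁻ s, 3 * w (s + a) * ‖x (t - s)‖ₑ :=
        lintegral_lintegral_swap (Measurable.aemeasurable (by fun_prop))
    _ = ∫⁻ a in Set.Icc (0 : ℝ) 1, ∫⁻ s, 3 * w s * ‖x (a + (t - s))‖ₑ := by
        congr with a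
        rw [← lintegral_sub_right_eq_self _ a]
        congr with s
        rw [sub_add_cancel]
        congr 3
        ring
    _ = ∫⁻ s, ∫⁻ a in Set.Icc (0 : ℝ) 1, 3 * w s * ‖x (a + (t - s))‖ₑ :=
        lintegral_lintegral_swap (Measurable.aemeasurable (by fun_prop))
    _ ≤ ∫⁻ s, 3 * w s * C := lintegral_mono fun s => by
        rw [lintegral_const_mul _ (by fun_prop)]
        exact mul_le_mul_right (h _) _
    _ = 3 * ((∫⁻ s, w s) * C) := by
        simp_rw [mul_assoc]
        rw [lintegral_const_mul _ (by fun_prop), lintegral_mul_const _ hwm]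

/-- After Tonelli the inner integral runs over a translated window, so a single `D` serves all
kernels. -/
theorem IsStepanov.lintegral_Icc_conv_le {x : ℝ → X} (hx : IsStepanov x) (a b : ℝ) :
    ∃ D : ℝ≥0∞, D ≠ ⊤ ∧ ∀ k : ℝ → ℝ≥0∞, AEMeasurable k →
      ∫⁻ τ in Set.Icc a b, ∫⁻ s, k s * ‖x (τ - s)‖ₑ ≤ (∫⁻ s, k s) * D := by
  obtain ⟨D, hD, h⟩ := hx.exists_lintegral_Icc_le a b
  have hx' := hx.stronglyMeasurable
  refine ⟨D, hD, fun k hk => ?_⟩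
  rw [lintegral_lintegral_swap (hk.comp_snd.mul (Measurable.aemeasurable (by fun_prop)))]
  calc ∫⁻ s, ∫⁻ τ in Set.Icc a b, k s * ‖x (τ - s)‖ₑ ≤ ∫⁻ s, k s * D :=
        lintegral_mono fun s => by
          rw [lintegral_const_mul _ (by fun_prop)]
          exact mul_le_mul_right (h s) _
    _ = _ := lintegral_mul_const'' _ hk

theorem ae_lt_top_of_forall_setLIntegral_Icc_ne_top {g : ℝ → ℝ≥0∞} (hg : AEMeasurable g)
    (h : ∀ a b : ℝ, ∫⁻ t in Set.Icc a b, g t ≠ ⊤) : ∀ᵐ t, g t < ⊤ := by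
  have h1 : ∀ n : ℕ, ∀ᵐ t, t ∈ Set.Icc (-(n : ℝ)) n → g t < ⊤ := fun n =>
    (ae_restrict_iff' measurableSet_Icc).1 (ae_lt_top' hg.restrict (h _ _))
  filter_upwards [ae_all_iff.2 h1] with t ht
  obtain ⟨n, hn⟩ := exists_nat_ge |t|
  exact ht n (abs_le.1 hn)

theorem IsStepanov.ae_lintegral_conv_lt_top {x : ℝ → X} (hx : IsStepanov x) {k : ℝ → ℝ≥0∞}
    (hk : AEMeasurable k) (hk' : ∫⁻ s, k s ≠ ⊤) :
    ∀ᵐ t, ∫⁻ s, k s * ‖x (t - s)‖ₑ < ⊤ := by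
  have hx' := hx.stronglyMeasurable
  refine ae_lt_top_of_forall_setLIntegral_Icc_ne_top ?_ fun a b => ?_
  · exact (hk.comp_snd.mul (Measurable.aemeasurable (by fun_prop)) :
      AEMeasurable (fun p : ℝ × ℝ => k p.2 * ‖x (p.1 - p.2)‖ₑ)
        (volume.prod volume)).lintegral_prod_right'
  · obtain ⟨D, hD, h⟩ := hx.lintegral_Icc_conv_le a b
    exact ((h k hk).trans_lt (ENNReal.mul_lt_top hk'.lt_top hD.lt_top)).ne

variable [NormedSpace ℂ X]

theorem aestronglyMeasurable_clm_apply {α Y : Type*} [MeasurableSpace α] {μ : Measure α}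
    [NormedAddCommGroup Y] [NormedSpace ℂ Y]
    {K : α → X →L[ℂ] Y} {x : α → X} (hK : AEStronglyMeasurable K μ)
    (hx : AEStronglyMeasurable x μ) : AEStronglyMeasurable (fun a => K a (x a)) μ :=
  (ContinuousLinearMap.id ℂ (X →L[ℂ] Y)).aestronglyMeasurable_comp₂ hK hx

theorem integrable_opConv_of_lintegral {K : ℝ → X →L[ℂ] X} (hK : AEStronglyMeasurable K)
    {x : ℝ → X} (hx : StronglyMeasurable x) {t : ℝ}
    (h : ∫⁻ s, ‖K s‖ₑ * ‖x (t - s)‖ₑ < ⊤) : Integrable fun s => K s (x (t - s)) :=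
  ⟨aestronglyMeasurable_clm_apply hK (hx.comp_measurable (by fun_prop)).aestronglyMeasurable,
    (lintegral_mono fun s => (K s).le_opENorm _).trans_lt h⟩

theorem IsStepanov.ae_integrable_opConv {x : ℝ → X} (hx : IsStepanov x) {K : ℝ → X →L[ℂ] X}
    (hK : Integrable K) : ∀ᵐ t, Integrable fun s => K s (x (t - s)) := by
  filter_upwards [hx.ae_lintegral_conv_lt_top hK.1.enorm hK.2.ne] with t ht
  exact integrable_opConv_of_lintegral hK.1 hx.stronglyMeasurable ht

/-- The convolution converges everywhere for kernels that decay quadratically. -/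
theorem IsStepanov.integrable_opConv_of_decay {x : ℝ → X} (hx : IsStepanov x)
    {K : ℝ → X →L[ℂ] X} (hK : AEStronglyMeasurable K) {C : ℝ}
    (hC : ∀ s, ‖K s‖ ≤ C * (1 + s ^ 2)⁻¹) (t : ℝ) : Integrable fun s => K s (x (t - s)) := by
  obtain ⟨D, hD, h⟩ := hx.exists_lintegral_inv_one_add_sq_le
  refine integrable_opConv_of_lintegral hK hx.stronglyMeasurable ?_
  calc ∫⁻ s, ‖K s‖ₑ * ‖x (t - s)‖ₑ
      ≤ ∫⁻ s, ENNReal.ofReal C * (ENNReal.ofReal (1 + s ^ 2)⁻¹ * ‖x (t - s)‖ₑ) :=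
        lintegral_mono fun s => by
          rw [← mul_assoc, ← ENNReal.ofReal_mul' (by positivity)]
          exact mul_le_mul_left (by
            rw [← ofReal_norm]
            exact ENNReal.ofReal_le_ofReal (hC s)) _
    _ = ENNReal.ofReal C * ∫⁻ s, ENNReal.ofReal (1 + s ^ 2)⁻¹ * ‖x (t - s)‖ₑ :=
        lintegral_const_mul' _ _ (by simp)
    _ < ⊤ := ENNReal.mul_lt_top (by simp) ((h t).trans_lt hD.lt_top)

theorem opConv_congr_ae {x x' : ℝ → X} (h : x =ᵐ[volume] x') (K : ℝ → X →L[ℂ] X) (t : ℝ) :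
    opConv K x t = opConv K x' t := by
  refine integral_congr_ae ?_
  filter_upwards [(Measure.measurePreserving_sub_left volume t).quasiMeasurePreserving.ae h]
    with s hs
  rw [hs]

theorem scalarConv_eq_opConv (f : ℝ → ℂ) (x : ℝ → X) :
    scalarConv f x = opConv (fun s => f s • (1 : X →L[ℂ] X)) x := rfl

/-- Iterated convolution as a double integral. -/
theorem IsStepanov.opConv_opConv [CompleteSpace X] {x : ℝ → X} (hx : IsStepanov x)
    {K L : ℝ → X →L[ℂ] X} (hK : Integrable K) (hL : Integrable L) :
    ∀ᵐ t, Integrable (fun p : ℝ × ℝ => K p.1 (L p.2 (x (t - p.1 - p.2)))) ∧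
      opConv K (opConv L x) t = ∫ p : ℝ × ℝ, K p.1 (L p.2 (x (t - p.1 - p.2))) := by
  have hx' := hx.stronglyMeasurable
  have hfin : ∀ᵐ t, ∫⁻ s, ‖K s‖ₑ * ∫⁻ r, ‖L r‖ₑ * ‖x (t - s - r)‖ₑ < ⊤ := by
    have hm : AEMeasurable (fun q : ℝ × ℝ => ‖K q.2‖ₑ * ∫⁻ r, ‖L r‖ₑ * ‖x (q.1 - q.2 - r)‖ₑ)
        (volume.prod volume) := by
      refine hK.1.enorm.comp_snd.mul ?_
      refine AEMeasurable.lintegral_prod_right' (ν := volume)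
        (f := fun q : (ℝ × ℝ) × ℝ => ‖L q.2‖ₑ * ‖x (q.1.1 - q.1.2 - q.2)‖ₑ) ?_
      exact hL.1.enorm.comp_snd.mul (Measurable.aemeasurable (by fun_prop))
    refine ae_lt_top_of_forall_setLIntegral_Icc_ne_top hm.lintegral_prod_right' fun a b => ?_
    obtain ⟨D, hD, h⟩ := hx.exists_lintegral_Icc_le a b
    rw [lintegral_lintegral_swap (hm.mono_ac
      (Measure.AbsolutelyContinuous.prod Measure.absolutelyContinuous_restrict
        Measure.AbsolutelyContinuous.rfl))]
    refine ne_top_of_le_ne_top (b := ∫⁻ s, ‖K s‖ₑ * ((∫⁻ r, ‖L r‖ₑ) * D)) ?_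
      (lintegral_mono fun s => ?_)
    · rw [lintegral_mul_const'' _ hK.1.enorm]
      exact ENNReal.mul_ne_top hK.2.ne (ENNReal.mul_ne_top hL.2.ne hD)
    · rw [lintegral_const_mul' _ _ enorm_ne_top]
      refine mul_le_mul_right ?_ _
      rw [lintegral_lintegral_swap (hL.1.enorm.comp_snd.mul
        (Measurable.aemeasurable (by fun_prop))), ← lintegral_mul_const'' _ hL.1.enorm]
      refine lintegral_mono fun r => ?_
      rw [lintegral_const_mul _ (by fun_prop)]
      refine mul_le_mul_right ?_ _
      simpa only [sub_sub] using h (s + r)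
  filter_upwards [hfin] with t ht
  have hm : AEStronglyMeasurable (fun p : ℝ × ℝ => K p.1 (L p.2 (x (t - p.1 - p.2))))
      (volume.prod volume) :=
    aestronglyMeasurable_clm_apply hK.1.comp_fst (aestronglyMeasurable_clm_apply hL.1.comp_snd
      (hx.stronglyMeasurable.comp_measurable (by fun_prop)).aestronglyMeasurable)
  have hint : Integrable (fun p : ℝ × ℝ => K p.1 (L p.2 (x (t - p.1 - p.2))))
      (volume.prod volume) := by
    refine ⟨hm, ?_⟩
    rw [HasFiniteIntegral, lintegral_prod _ hm.enorm]
    refine (lintegral_mono fun s => ?_).trans_lt ht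
    rw [← lintegral_const_mul' _ _ enorm_ne_top]
    exact lintegral_mono fun r => ((K s).le_opENorm _).trans
      (mul_le_mul_right ((L r).le_opENorm _) _)
  refine ⟨hint, ?_⟩
  change _ = ∫ p, _ ∂(volume.prod volume)
  rw [integral_prod _ hint]
  refine integral_congr_ae ?_
  filter_upwards [(Measure.measurePreserving_sub_left volume t).quasiMeasurePreserving.ae
    (hx.ae_integrable_opConv hL)] with s hs
  exact ((K s).integral_comp_comm hs).symm

/-- Convolutions with pointwise commuting kernels commute. -/
theorem IsStepanov.opConv_comm [CompleteSpace X] {x : ℝ → X} (hx : IsStepanov x)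
    {K L : ℝ → X →L[ℂ] X} (hK : Integrable K) (hL : Integrable L)
    (hKL : ∀ s r v, K s (L r v) = L r (K s v)) :
    opConv K (opConv L x) =ᵐ[volume] opConv L (opConv K x) := by
  filter_upwards [hx.opConv_opConv hK hL, hx.opConv_opConv hL hK] with t h1 h2
  rw [h1.2, h2.2]
  change ∫ p, _ ∂(volume.prod volume) = ∫ p, _ ∂(volume.prod volume)
  rw [← integral_prod_swap]
  congr with p
  simp only [Prod.fst_swap, Prod.snd_swap]
  rw [hKL, sub_right_comm]

/-- Convolution with scalar kernels is associative. -/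
theorem IsStepanov.scalarConv_scalarConv [CompleteSpace X] {x : ℝ → X} (hx : IsStepanov x)
    {f g : ℝ → ℂ} (hf : Integrable f) (hg : Integrable g) :
    scalarConv f (scalarConv g x) =ᵐ[volume] scalarConv (scalarConv f g) x := by
  have := hx.opConv_opConv (hf.smul_const (1 : X →L[ℂ] X)) (hg.smul_const (1 : X →L[ℂ] X))
  filter_upwards [this] with t ht
  rw [scalarConv_eq_opConv, scalarConv_eq_opConv, ht.2]
  have h1 := ht.1
  simp only [smul_apply, one_apply_eq_self] at h1 ⊢
  -- The measure-preserving shear `(s, r) ↦ (s, s + r)` exposes `f * g` as the inner integral.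
  set G : ℝ × ℝ → X := fun p => f p.1 • g (p.2 - p.1) • x (t - p.2) with hG
  have hcomp : (fun p : ℝ × ℝ => f p.1 • g p.2 • x (t - p.1 - p.2)) =
      G ∘ fun p : ℝ × ℝ => (p.1, p.1 + p.2) := by
    ext p
    simp only [hG, Function.comp_apply, add_sub_cancel_left, sub_sub]
  have hmp := measurePreserving_prod_add (volume : Measure ℝ) (volume : Measure ℝ)
  have hme : MeasurableEmbedding fun p : ℝ × ℝ => (p.1, p.1 + p.2) :=
    (MeasurableEquiv.shearAddRight ℝ).measurableEmbedding
  rw [hcomp] at h1 ⊢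
  have hGi : Integrable G (volume.prod volume) := (hmp.integrable_comp_emb hme).1 h1
  have e := hmp.integral_comp hme G
  refine e.trans ?_
  rw [integral_prod_symm _ hGi]
  simp only [hG, smul_smul, scalarConv]
  congr with r
  rw [integral_smul_const]
  rfl

end Stepanov

/-! ### Integrable kernels acting on a homogeneous space. -/

theorem MeasureTheory.Integrable.scalarConv {f g : ℝ → ℂ} (hf : Integrable f)
    (hg : Integrable g) : Integrable (scalarConv f g) :=
  hf.integrable_convolution (ContinuousLinearMap.lsmul ℂ ℂ) hg

section MemL1s

variable {X : Type*} [NormedAddCommGroup X] [NormedSpace ℂ X]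

theorem MeasureTheory.Integrable.isMajorant {K : ℝ → X →L[ℂ] X} (hK : Integrable K) :
    IsMajorant K fun s => ‖K s‖ :=
  ⟨hK.norm, ae_of_all _ fun _ => le_rfl⟩

theorem MeasureTheory.Integrable.memL1s {K : ℝ → X →L[ℂ] X} (hK : Integrable K) : MemL1s K :=
  ⟨fun v => hK.1.apply_continuousLinearMap v, _, hK.isMajorant⟩

theorem MeasureTheory.Integrable.normL1s_le {K : ℝ → X →L[ℂ] X} (hK : Integrable K) :
    normL1s K ≤ ∫ s, ‖K s‖ := by
  refine csInf_le ⟨0, ?_⟩ ⟨_, hK.isMajorant, by simp⟩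
  rintro c ⟨f, -, rfl⟩
  exact integral_nonneg fun s => norm_nonneg _

end MemL1s

namespace HomogeneousSpace

variable {X E : Type*} [NormedAddCommGroup X] [NormedSpace ℂ X]
  [NormedAddCommGroup E] [NormedSpace ℂ E]

theorem isStepanov (F : HomogeneousSpace X E) (x : E) : IsStepanov (F.toAE x) :=
  ⟨(F.toAE x).stronglyMeasurable, by
    obtain ⟨C, hC⟩ := F.stepanov_bound
    exact ⟨_, ENNReal.ofReal_ne_top, hC x⟩⟩

theorem ext_ae (F : HomogeneousSpace X E) {x y : E}
    (h : F.toAE x =ᵐ[volume] F.toAE y) : x = y :=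
  F.toAE_injective (AEEqFun.ext h)

theorem toAE_sub_ae (F : HomogeneousSpace X E) (x y : E) :
    F.toAE (x - y) =ᵐ[volume] fun t => F.toAE x t - F.toAE y t := by
  rw [map_sub]
  exact AEEqFun.coeFn_sub _ _

theorem toAE_smul_ae (F : HomogeneousSpace X E) (c : ℂ) (x : E) :
    F.toAE (c • x) =ᵐ[volume] fun t => c • F.toAE x t := by
  rw [map_smul]
  exact AEEqFun.coeFn_smul _ _

theorem toAE_zero_ae (F : HomogeneousSpace X E) : F.toAE 0 =ᵐ[volume] fun _ => 0 := by
  rw [map_zero]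
  exact AEEqFun.coeFn_zero

open Classical in
/-- The convolution action of operator-valued kernels on a homogeneous space. -/
noncomputable def act (F : HomogeneousSpace X E) (K : ℝ → X →L[ℂ] X) (x : E) : E :=
  if h : MemL1s K then Classical.choose (F.convolution K h x) else 0

/-- The convolution action of scalar kernels on a homogeneous space. -/
noncomputable def sact (F : HomogeneousSpace X E) (f : ℝ → ℂ) (x : E) : E :=
  F.act (fun s => f s • (1 : X →L[ℂ] X)) x

variable (F : HomogeneousSpace X E)

theorem toAE_act {K : ℝ → X →L[ℂ] X} (hK : Integrable K) (x : E) :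
    F.toAE (F.act K x) =ᵐ[volume] opConv K (F.toAE x) := by
  rw [act, dif_pos hK.memL1s]
  exact (Classical.choose_spec (F.convolution K hK.memL1s x)).1

theorem norm_act_le {K : ℝ → X →L[ℂ] X} (hK : Integrable K) (x : E) :
    ‖F.act K x‖ ≤ (∫ s, ‖K s‖) * ‖x‖ := by
  rw [act, dif_pos hK.memL1s]
  exact (Classical.choose_spec (F.convolution K hK.memL1s x)).2.trans
    (mul_le_mul_of_nonneg_right hK.normL1s_le (norm_nonneg _))

theorem toAE_sact {f : ℝ → ℂ} (hf : Integrable f) (x : E) :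
    F.toAE (F.sact f x) =ᵐ[volume] scalarConv f (F.toAE x) :=
  F.toAE_act (hf.smul_const _) x

theorem norm_sact_le {f : ℝ → ℂ} (hf : Integrable f) (x : E) :
    ‖F.sact f x‖ ≤ (∫ s, ‖f s‖) * ‖x‖ := by
  refine (F.norm_act_le (hf.smul_const _) x).trans
    (mul_le_mul_of_nonneg_right (integral_mono (hf.smul_const _).norm hf.norm fun s => ?_)
      (norm_nonneg _))
  rw [norm_smul]
  exact mul_le_of_le_one_right (norm_nonneg _) ContinuousLinearMap.norm_id_le

theorem sact_eq_zero_iff {f : ℝ → ℂ} (hf : Integrable f) (x : E) :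
    F.sact f x = 0 ↔ ∀ᵐ t, scalarConv f (F.toAE x) t = 0 := by
  have h := F.toAE_sact hf x
  constructor
  · intro h0
    rw [h0] at h
    filter_upwards [h, F.toAE_zero_ae] with t h1 h2
    rw [← h1, h2]
  · intro h0
    refine F.ext_ae ?_
    filter_upwards [h, h0, F.toAE_zero_ae] with t h1 h2 h3
    rw [h1, h2, h3]

theorem act_sub {K : ℝ → X →L[ℂ] X} (hK : Integrable K) (x y : E) :
    F.act K (x - y) = F.act K x - F.act K y := by
  refine F.ext_ae ?_
  filter_upwards [F.toAE_act hK (x - y), F.toAE_sub_ae (F.act K x) (F.act K y), F.toAE_act hK x,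
    F.toAE_act hK y, (F.isStepanov x).ae_integrable_opConv hK,
    (F.isStepanov y).ae_integrable_opConv hK] with t h1 h2 h3 h4 h5 h6
  rw [h1, h2, h3, h4, opConv_congr_ae (F.toAE_sub_ae x y)]
  simp only [opConv, map_sub]
  exact integral_sub h5 h6

theorem act_zero {K : ℝ → X →L[ℂ] X} (hK : Integrable K) : F.act K 0 = 0 := by
  simpa using F.act_sub hK 0 0

theorem sact_sub {f : ℝ → ℂ} (hf : Integrable f) (x y : E) :
    F.sact f (x - y) = F.sact f x - F.sact f y :=
  F.act_sub (hf.smul_const _) x y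

theorem sact_zero {f : ℝ → ℂ} (hf : Integrable f) : F.sact f (0 : E) = 0 :=
  F.act_zero (hf.smul_const _)

theorem sact_sub_left {f g : ℝ → ℂ} (hf : Integrable f) (hg : Integrable g) (x : E) :
    F.sact (fun s => f s - g s) x = F.sact f x - F.sact g x := by
  refine F.ext_ae ?_
  filter_upwards [F.toAE_sact (hf.sub hg) x, F.toAE_sub_ae (F.sact f x) (F.sact g x),
    F.toAE_sact hf x, F.toAE_sact hg x,
    (F.isStepanov x).ae_integrable_opConv (hf.smul_const (1 : X →L[ℂ] X)),
    (F.isStepanov x).ae_integrable_opConv (hg.smul_const (1 : X →L[ℂ] X))] with t h1 h2 h3 h4 h5 h6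
  refine h1.trans ?_
  rw [h2, h3, h4]
  simp only [scalarConv, Pi.sub_apply, sub_smul]
  exact integral_sub h5 h6

theorem sact_const_mul {f : ℝ → ℂ} (hf : Integrable f) (c : ℂ) (x : E) :
    F.sact (fun s => c * f s) x = c • F.sact f x := by
  refine F.ext_ae ?_
  filter_upwards [F.toAE_sact (hf.const_mul c) x, F.toAE_smul_ae c (F.sact f x),
    F.toAE_sact hf x] with t h1 h2 h3
  rw [h1, h2, h3]
  simp only [scalarConv, mul_smul]
  exact integral_smul _ _

/-- The Beurling spectrum decreases when the annihilator in `L¹` grows. -/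
theorem beurlingSpectrum_subset_of_sact {x y : E}
    (h : ∀ f : ℝ → ℂ, Integrable f → F.sact f x = 0 → F.sact f y = 0) :
    F.beurlingSpectrum y ⊆ F.beurlingSpectrum x := by
  refine Set.compl_subset_compl.2 fun l ⟨f, hf, hl, h0⟩ => ⟨f, hf, hl, ?_⟩
  exact (F.sact_eq_zero_iff hf y).1 (h f hf ((F.sact_eq_zero_iff hf x).2 h0))

variable [CompleteSpace X]

theorem act_act_comm {K L : ℝ → X →L[ℂ] X} (hK : Integrable K) (hL : Integrable L)
    (hKL : ∀ s r v, K s (L r v) = L r (K s v)) (x : E) :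
    F.act K (F.act L x) = F.act L (F.act K x) := by
  refine F.ext_ae ?_
  filter_upwards [F.toAE_act hK (F.act L x), F.toAE_act hL (F.act K x),
    (F.isStepanov x).opConv_comm hK hL hKL] with t h1 h2 h3
  rw [h1, h2, opConv_congr_ae (F.toAE_act hL x), h3, opConv_congr_ae (F.toAE_act hK x)]

theorem sact_act_comm {f : ℝ → ℂ} (hf : Integrable f) {K : ℝ → X →L[ℂ] X} (hK : Integrable K)
    (x : E) : F.sact f (F.act K x) = F.act K (F.sact f x) :=
  F.act_act_comm (hf.smul_const _) hK (fun s r v => by simp) x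

theorem sact_sact_comm {f g : ℝ → ℂ} (hf : Integrable f) (hg : Integrable g) (x : E) :
    F.sact f (F.sact g x) = F.sact g (F.sact f x) :=
  F.sact_act_comm hf (hg.smul_const _) x

theorem sact_sact {f g : ℝ → ℂ} (hf : Integrable f) (hg : Integrable g) (x : E) :
    F.sact f (F.sact g x) = F.sact (scalarConv f g) x := by
  refine F.ext_ae ?_
  filter_upwards [F.toAE_sact hf (F.sact g x), F.toAE_sact (hf.scalarConv hg) x,
    (F.isStepanov x).scalarConv_scalarConv hf hg] with t h1 h2 h3
  rw [h1, h2, ← h3, scalarConv_eq_opConv, opConv_congr_ae (F.toAE_sact hg x)]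
  rfl

end HomogeneousSpace

/-! ### Local units and approximate identities in `L¹`. -/

section Localization

/-- An integrable function is approximated, in the algebra `L¹` and near a given frequency,
by multiples of kernels that are units near that frequency. -/
theorem exists_local_unit {f : ℝ → ℂ} (hf : Integrable f) (l₀ : ℝ) {c : ℝ} (hc : 0 < c) :
    ∃ V : ℝ → ℂ, Integrable V ∧ (∃ δ > 0, ∀ l, |l - l₀| ≤ δ → scalarFourier V l = 1) ∧
      ∫ t, ‖scalarConv f V t - scalarFourier f l₀ * V t‖ < c := by
  let b : ContDiffBump (0 : ℝ) := ⟨1, 2, one_pos, one_lt_two⟩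
  set χ : ℝ → ℂ := fun l => (b l : ℂ) with hχ
  have hχs : ContDiff ℝ ∞ χ := Complex.ofRealCLM.contDiff.comp b.contDiff
  have hχc : HasCompactSupport χ := b.hasCompactSupport.comp_left (g := Complex.ofReal) rfl
  have hVi := hχc.integrable_fourierSynthesis hχs
  -- Modulation moves `l₀` to frequency zero: the integral of `k` is the transform of `f` at `l₀`.
  let k : ℝ → ℂ := fun s => f s * Complex.exp (-(Complex.I * s * l₀))
  have hk : Integrable k := hf.mono (hf.1.mul (Continuous.aestronglyMeasurable (by fun_prop)))
    (ae_of_all _ fun s => by simp only [k, norm_mul, norm_exp_neg_I_mul, mul_one, le_refl])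
  obtain ⟨n, hn⟩ := ((tendsto_lintegral_mul_meanModulus hk hVi
    tendsto_one_div_add_atTop_nhds_zero_nat).eventually_lt_const
      (ENNReal.ofReal_pos.2 hc)).exists
  set ε : ℝ := 1 / ((n : ℝ) + 1)
  have hε : 0 < ε := by positivity
  -- `W` is so flat that convolution with `k` is nearly multiplication by the integral of `k`.
  -- Modulated back to `l₀`, its transform is `1` within distance `ε`, since `χ = 1` on `[-1, 1]`.
  set W : ℝ → ℂ := fun t => ε • fourierSynthesis χ (ε * t) with hW
  have hWi : Integrable W := (hVi.comp_mul_left' hε.ne').smul ε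
  set χε : ℝ → ℂ := fun l => χ (ε⁻¹ * (l - l₀)) with hχε
  have hχεs : ContDiff ℝ ∞ χε := hχs.comp (by fun_prop)
  have hχεc : HasCompactSupport χε := by
    have := hχc.comp_homeomorph
      ((Homeomorph.subRight l₀).trans (Homeomorph.mulLeft₀ ε⁻¹ (inv_pos.2 hε).ne'))
    exact this
  have hV : ∀ t, fourierSynthesis χε t = Complex.exp (Complex.I * l₀ * t) * W t := fun t => by
    rw [fourierSynthesis_comp_sub_right (fun l => χ (ε⁻¹ * l)),
      fourierSynthesis_comp_mul_left χ (inv_pos.2 hε), inv_inv, smul_eq_mul]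
  have hVεi := hχεc.integrable_fourierSynthesis hχεs
  refine ⟨fourierSynthesis χε, hVεi, ⟨ε, hε, fun l hl => ?_⟩, ?_⟩
  · rw [scalarFourier_fourierSynthesis hχεc hχεs, hχε, hχ]
    have : b (ε⁻¹ * (l - l₀)) = 1 := by
      refine b.one_of_mem_closedBall ?_
      rw [mem_closedBall_zero_iff, norm_mul, Real.norm_eq_abs, Real.norm_eq_abs,
        abs_of_pos (inv_pos.2 hε), inv_mul_le_iff₀ hε]
      simpa [b] using hl
    simp only [this, Complex.ofReal_one]
  · have hbd := lintegral_enorm_integral_mul_sub_le hk hWi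
    simp only [hW, meanModulus_dilation (fourierSynthesis χ) hε] at hbd
    have hlt := hbd.trans_lt hn
    have hD : Integrable fun t => scalarConv f (fourierSynthesis χε) t -
        scalarFourier f l₀ * fourierSynthesis χε t :=
      (hf.scalarConv hVεi).sub (hVεi.const_mul _)
    rw [← ENNReal.ofReal_lt_ofReal_iff hc, ofReal_integral_norm_eq_lintegral_enorm hD]
    refine lt_of_le_of_lt (le_of_eq (lintegral_congr_ae ?_)) hlt
    have hex : ∀ᵐ t, Integrable fun s => f s * fourierSynthesis χε (t - s) :=
      hf.ae_convolution_exists (ContinuousLinearMap.mul ℂ ℂ) hVεi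
    filter_upwards [hex] with t ht
    have key : scalarConv f (fourierSynthesis χε) t -
        scalarFourier f l₀ * fourierSynthesis χε t =
        Complex.exp (Complex.I * l₀ * t) * ∫ s, k s * (W (t - s) - W t) := by
      rw [scalarConv, scalarFourier, ← integral_mul_const, ← integral_const_mul]
      simp only [smul_eq_mul]
      rw [← integral_sub ht (hk.mul_const _)]
      congr 1
      ext s
      rw [hV, hV]
      have : Complex.exp (Complex.I * l₀ * (t - s : ℝ)) =
          Complex.exp (Complex.I * l₀ * t) * Complex.exp (-(Complex.I * s * l₀)) := by
        rw [← Complex.exp_add]; congr 1; push_cast; ring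
      rw [this]
      ring
    rw [key, enorm_mul, ← ofReal_norm (Complex.exp _), norm_exp_I_mul, ENNReal.ofReal_one,
      one_mul]

/-- Convolution with dilated kernels is an approximate identity. -/
theorem tendsto_lintegral_scalarConv_sub {f χ : ℝ → ℂ} (hf : Integrable f)
    (hχc : HasCompactSupport χ) (hχs : ContDiff ℝ ∞ χ) (h1 : χ 0 = 1) :
    Tendsto (fun n : ℕ => ∫⁻ t, ‖scalarConv (fourierSynthesis
      fun l => χ ((1 / ((n : ℝ) + 1)) * l)) f t - f t‖ₑ) atTop (𝓝 0) := by
  have he := hχc.integrable_fourierSynthesis hχs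
  refine tendsto_of_tendsto_of_tendsto_of_le_of_le tendsto_const_nhds
    (tendsto_lintegral_mul_meanModulus he hf tendsto_one_div_add_atTop_nhds_zero_nat)
    (fun _ => zero_le) fun n => ?_
  set ε : ℝ := 1 / ((n : ℝ) + 1)
  have hε : 0 < ε := by positivity
  -- The transform at zero is the total integral, so the dilated kernel has mass one.
  have hχ0 : scalarFourier (fourierSynthesis fun l => χ (ε * l)) 0 = 1 := by
    rw [scalarFourier_fourierSynthesis (χ := fun l => χ (ε * l)), mul_zero, h1]
    · exact hχc.comp_homeomorph (Homeomorph.mulLeft₀ ε hε.ne')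
    · exact hχs.comp (by fun_prop)
  have he' : (fourierSynthesis fun l => χ (ε * l)) =
      fun t => ε⁻¹ • fourierSynthesis χ (ε⁻¹ * t) :=
    funext fun t => fourierSynthesis_comp_mul_left χ hε t
  rw [he'] at hχ0 ⊢
  set e := fun t => ε⁻¹ • fourierSynthesis χ (ε⁻¹ * t) with hedef
  have hei : Integrable e := (he.comp_mul_left' (inv_pos.2 hε).ne').smul ε⁻¹
  have hint : ∫ s, e s = 1 := by
    rw [← hχ0, scalarFourier]
    simp
  have hex : ∀ᵐ t, Integrable fun s => e s * f (t - s) :=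
    hei.ae_convolution_exists (ContinuousLinearMap.mul ℂ ℂ) hf
  calc ∫⁻ t, ‖scalarConv e f t - f t‖ₑ = ∫⁻ t, ‖∫ s, e s * (f (t - s) - f t)‖ₑ := by
        refine lintegral_congr_ae ?_
        filter_upwards [hex] with t ht
        simp only [mul_sub]
        rw [integral_sub ht (hei.mul_const _), integral_mul_const, hint, one_mul]
        rfl
    _ ≤ ∫⁻ s, ‖e s‖ₑ * meanModulus f s := lintegral_enorm_integral_mul_sub_le hei hf
    _ = ∫⁻ s, ‖fourierSynthesis χ s‖ₑ * meanModulus f (ε * s) := by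
        have := lintegral_comp_mul_left
          (fun s => ‖fourierSynthesis χ s‖ₑ * meanModulus f (ε * s)) (inv_pos.2 hε)
        simp only [mul_inv_cancel_left₀ hε.ne', inv_inv] at this
        simp only [hedef, enorm_smul, mul_assoc]
        rw [lintegral_const_mul' _ _ enorm_ne_top, this, ← mul_assoc,
          Real.enorm_of_nonneg (inv_pos.2 hε).le, ← ENNReal.ofReal_mul (inv_pos.2 hε).le,
          inv_mul_cancel₀ hε.ne', ENNReal.ofReal_one, one_mul]

theorem exists_smooth_cutoff {K U : Set ℝ} (hK : IsCompact K) (hU : IsOpen U) (hKU : K ⊆ U) :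
    ∃ φ : ℝ → ℂ, ContDiff ℝ ∞ φ ∧ HasCompactSupport φ ∧ tsupport φ ⊆ U ∧
      ∃ V : Set ℝ, IsOpen V ∧ K ⊆ V ∧ ∀ l ∈ V, φ l = 1 := by
  obtain ⟨L, hL, hKL, hLU⟩ := exists_compact_between hK hU hKU
  obtain ⟨g, h1, h0, -⟩ := exists_contMDiffMap_one_nhds_of_subset_interior (n := ⊤)
    (modelWithCornersSelf ℝ ℝ) hK.isClosed hKL
  have hsub : tsupport (fun l => (g l : ℂ)) ⊆ L := by
    refine closure_minimal (fun l hl => ?_) hL.isClosed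
    by_contra hn
    exact hl (by simp [h0 l hn])
  obtain ⟨V, hV, hKV, hVg⟩ := mem_nhdsSet_iff_exists.1 h1
  refine ⟨fun l => (g l : ℂ), Complex.ofRealCLM.contDiff.comp g.contMDiff.contDiff,
    hL.of_isClosed_subset (isClosed_tsupport _) hsub, hsub.trans hLU, V, hV, hKV, fun l hl => ?_⟩
  have : g l = 1 := hVg hl
  simp [this]

end Localization

/-! ### Spectral localization in a homogeneous space. -/

namespace HomogeneousSpace

variable {X E : Type*} [NormedAddCommGroup X] [NormedSpace ℂ X] [CompleteSpace X]
  [NormedAddCommGroup E] [NormedSpace ℂ E] (F : HomogeneousSpace X E)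

/-- Convolution with a kernel of small spectrum near a point outside the Beurling spectrum
gives zero. -/
theorem exists_sact_fourierSynthesis_eq_zero {x : E} {l₀ : ℝ}
    (hl : l₀ ∉ F.beurlingSpectrum x) :
    ∃ U : Set ℝ, IsOpen U ∧ l₀ ∈ U ∧ ∀ χ : ℝ → ℂ, ContDiff ℝ ∞ χ → HasCompactSupport χ →
      tsupport χ ⊆ U → F.sact (fourierSynthesis χ) x = 0 := by
  obtain ⟨f, hf, hfl, h0⟩ := Set.notMem_compl_iff.1 hl
  rw [← F.sact_eq_zero_iff hf] at h0
  obtain ⟨V, hV, ⟨δ, hδ, hVδ⟩, hlt⟩ := exists_local_unit hf l₀ (norm_pos_iff.2 hfl)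
  refine ⟨Metric.ball l₀ δ, Metric.isOpen_ball, Metric.mem_ball_self hδ, fun χ hs hc hsub => ?_⟩
  set g := fourierSynthesis χ
  have hg : Integrable g := hc.integrable_fourierSynthesis hs
  have hVg : scalarConv V g = g := by
    ext t
    rw [scalarConv_fourierSynthesis hV (hs.continuous.integrable_of_hasCompactSupport hc)]
    refine congrArg (fourierSynthesis · t) (funext fun l => ?_)
    by_cases hm : l ∈ tsupport χ
    · rw [hVδ l (by simpa [Real.dist_eq] using (Metric.mem_ball.1 (hsub hm)).le), one_mul]
    · rw [image_eq_zero_of_notMem_tsupport hm, mul_zero]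
  set u := F.sact g x
  have hVu : F.sact V u = u := by rw [F.sact_sact hV hg, hVg]
  have hfVu : F.sact (scalarConv f V) u = 0 := by
    rw [← F.sact_sact hf hV, hVu, F.sact_sact_comm hf hg, h0, F.sact_zero hg]
  -- The kernel on the left has `L¹` norm below `‖f̂(l₀)‖`, yet it acts on `u` as multiplication by
  -- `-f̂(l₀)`; this forces `u = 0`.
  have hdiff : F.sact (fun t => scalarConv f V t - scalarFourier f l₀ * V t) u =
      -(scalarFourier f l₀ • u) := by
    rw [F.sact_sub_left (hf.scalarConv hV) (hV.const_mul _), hfVu, F.sact_const_mul hV, hVu,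
      zero_sub]
  have hle := F.norm_sact_le ((hf.scalarConv hV).sub (hV.const_mul (scalarFourier f l₀))) u
  by_contra hu
  have hu' : 0 < ‖u‖ := norm_pos_iff.2 hu
  have := (congrArg norm hdiff).symm.trans_le hle
  rw [norm_neg, norm_smul] at this
  exact absurd (le_of_mul_le_mul_right this hu') (not_le.2 hlt)

/-- Convolution with a kernel whose spectrum avoids the Beurling spectrum gives zero. -/
theorem sact_fourierSynthesis_eq_zero {x : E} {χ : ℝ → ℂ} (hs : ContDiff ℝ ∞ χ)
    (hc : HasCompactSupport χ) (hd : Disjoint (tsupport χ) (F.beurlingSpectrum x)) :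
    F.sact (fourierSynthesis χ) x = 0 := by
  -- Asking for an open neighbourhood that works for all test functions supported in it makes the
  -- property local, as compact induction needs.
  let P : Set ℝ → Prop := fun K => ∃ U : Set ℝ, IsOpen U ∧ K ⊆ U ∧
    ∀ χ : ℝ → ℂ, ContDiff ℝ ∞ χ → HasCompactSupport χ →
      tsupport χ ⊆ U → F.sact (fourierSynthesis χ) x = 0
  have hP : P (tsupport χ) := by
    refine IsCompact.induction_on (p := P) hc ?_ ?_ ?_ ?_
    · refine ⟨∅, isOpen_empty, le_rfl, fun χ hs hc hsub => ?_⟩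
      obtain rfl : χ = 0 := tsupport_eq_empty_iff.1 (Set.subset_empty_iff.1 hsub)
      have hi := hc.integrable_fourierSynthesis hs
      refine (F.sact_eq_zero_iff hi x).2 (ae_of_all _ fun t => ?_)
      simp [scalarConv, fourierSynthesis]
    · rintro s t hst ⟨U, hU, htU, h⟩
      exact ⟨U, hU, hst.trans htU, h⟩
    · rintro s t ⟨U, hU, hsU, h⟩ ⟨V, hV, htV, h'⟩
      refine ⟨U ∪ V, hU.union hV, Set.union_subset_union hsU htV, fun χ hs hc hsub => ?_⟩
      -- A cutoff `ρ` equal to `1` near this set splits `χ` into `ρχ`, supported in `U`, and `χ -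
      -- ρχ`, supported in `V`.
      have hK : IsCompact (tsupport χ \ V) := IsCompact.diff hc hV
      obtain ⟨ρ, hρs, hρc, hρU, W, hW, hKW, hρ1⟩ := exists_smooth_cutoff hK hU
        fun l hl => (hsub hl.1).resolve_right hl.2
      have hs1 : ContDiff ℝ ∞ fun l => ρ l * χ l := hρs.mul hs
      have hc1 : HasCompactSupport fun l => ρ l * χ l := hc.mul_left
      have hs2 : ContDiff ℝ ∞ fun l => χ l - ρ l * χ l := hs.sub hs1
      have hc2 : HasCompactSupport fun l => χ l - ρ l * χ l := hc.sub hc1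
      have e1 := h _ hs1 hc1 ((tsupport_mul_subset_left (f := ρ) (g := χ)).trans hρU)
      have e2 := h' _ hs2 hc2 (by
        have hsub2 : tsupport (fun l => χ l - ρ l * χ l) ⊆ tsupport χ ∩ Wᶜ := by
          refine closure_minimal (fun l hl => ⟨subset_closure fun h0 => hl ?_, fun hlW => hl ?_⟩)
            ((isClosed_tsupport _).inter hW.isClosed_compl)
          · simp [h0]
          · simp [hρ1 l hlW]
        intro l hl
        by_contra hlV
        exact (hsub2 hl).2 (hKW ⟨(hsub2 hl).1, hlV⟩))
      have i := hs.continuous.integrable_of_hasCompactSupport hc (μ := volume)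
      have i1 := hs1.continuous.integrable_of_hasCompactSupport hc1 (μ := volume)
      have : fourierSynthesis (fun l => χ l - ρ l * χ l) = fun t => fourierSynthesis χ t -
          fourierSynthesis (fun l => ρ l * χ l) t := funext fun t => fourierSynthesis_sub i i1 t
      rw [this, F.sact_sub_left (hc.integrable_fourierSynthesis hs)
        (hc1.integrable_fourierSynthesis hs1), e1, sub_zero] at e2
      exact e2
    · intro l hl
      obtain ⟨U, hU, hlU, h⟩ :=
        F.exists_sact_fourierSynthesis_eq_zero (Set.disjoint_left.1 hd hl)
      exact ⟨U, mem_nhdsWithin_of_mem_nhds (hU.mem_nhds hlU), U, hU, le_rfl, h⟩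
  obtain ⟨U, -, hsub, h⟩ := hP
  exact h χ hs hc hsub

/-- For band-limited approximate identities `eₙ`, the hypothesis gives `eₙ * f * z = 0`. Hence `‖f *
z‖ ≤ ‖eₙ * f - f‖₁ ‖z‖ → 0`, and nondegeneracy applies. -/
theorem eq_zero_of_forall_sact_fourierSynthesis {z : E}
    (h : ∀ χ : ℝ → ℂ, ContDiff ℝ ∞ χ → HasCompactSupport χ →
      F.sact (fourierSynthesis χ) z = 0) : z = 0 := by
  let b : ContDiffBump (0 : ℝ) := ⟨1, 2, one_pos, one_lt_two⟩
  set χ : ℝ → ℂ := fun l => (b l : ℂ) with hχ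
  have hχs : ContDiff ℝ ∞ χ := Complex.ofRealCLM.contDiff.comp b.contDiff
  have hχc : HasCompactSupport χ := b.hasCompactSupport.comp_left (g := Complex.ofReal) rfl
  have hχ1 : χ 0 = 1 := by
    simp [hχ, b.one_of_mem_closedBall (Metric.mem_closedBall_self b.rIn_pos.le)]
  refine F.nondegenerate z fun f hf => (F.sact_eq_zero_iff hf z).1 ?_
  have hlim := (tendsto_lintegral_scalarConv_sub hf hχc hχs hχ1)
  have hlim' := (ENNReal.tendsto_toReal ENNReal.zero_ne_top).comp hlim |>.mul_const ‖z‖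
  rw [ENNReal.toReal_zero, zero_mul] at hlim'
  refine norm_le_zero_iff.1 (ge_of_tendsto' hlim' fun n => ?_)
  set ε : ℝ := 1 / ((n : ℝ) + 1)
  have hε : 0 < ε := by positivity
  have hc : HasCompactSupport fun l => χ (ε * l) :=
    hχc.comp_homeomorph (Homeomorph.mulLeft₀ ε hε.ne')
  have hs : ContDiff ℝ ∞ fun l => χ (ε * l) := hχs.comp (by fun_prop)
  have he := hc.integrable_fourierSynthesis hs
  have e0 : F.sact (scalarConv (fourierSynthesis fun l => χ (ε * l)) f) z = 0 := by
    rw [← F.sact_sact he hf, F.sact_sact_comm he hf, h _ hs hc, F.sact_zero hf]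
  have hi := (he.scalarConv hf).sub hf
  have := F.norm_sact_le hi z
  rw [integral_norm_eq_lintegral_enorm hi.1] at this
  refine le_trans (le_of_eq ?_) this
  have e1 := F.sact_sub_left (he.scalarConv hf) hf z
  rw [e0, zero_sub] at e1
  rw [← norm_neg, ← e1]
  rfl

/-- A kernel whose Fourier transform is `1` near the Beurling spectrum acts as the identity. -/
theorem sact_fourierSynthesis_eq_self {x : E} {φ : ℝ → ℂ} (hs : ContDiff ℝ ∞ φ)
    (hc : HasCompactSupport φ) {U : Set ℝ} (hU : IsOpen U) (hxU : F.beurlingSpectrum x ⊆ U)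
    (h1 : ∀ l ∈ U, φ l = 1) : F.sact (fourierSynthesis φ) x = x := by
  have hφ := hc.integrable_fourierSynthesis hs
  refine (sub_eq_zero.1 (F.eq_zero_of_forall_sact_fourierSynthesis fun χ hχs hχc => ?_)).symm
  have hχ := hχc.integrable_fourierSynthesis hχs
  have hs1 : ContDiff ℝ ∞ fun l => χ l * φ l := hχs.mul hs
  have hc1 : HasCompactSupport fun l => χ l * φ l := hc.mul_left
  have i := hχs.continuous.integrable_of_hasCompactSupport hχc (μ := volume)
  have i1 := hs1.continuous.integrable_of_hasCompactSupport hc1 (μ := volume)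
  have e : scalarConv (fourierSynthesis χ) (fourierSynthesis φ) =
      fourierSynthesis fun l => χ l * φ l := by
    ext t
    rw [scalarConv_fourierSynthesis hχ (hs.continuous.integrable_of_hasCompactSupport hc)]
    simp only [scalarFourier_fourierSynthesis hχc hχs]
  rw [F.sact_sub hχ, F.sact_sact hχ hφ, e,
    ← F.sact_sub_left hχ (hc1.integrable_fourierSynthesis hs1),
    ← funext fun t => fourierSynthesis_sub i i1 t]
  -- The remaining symbol `χ(1 - φ)` vanishes on the open set `U`, so its closed support misses the
  -- spectrum of `x`.
  refine F.sact_fourierSynthesis_eq_zero (hχs.sub hs1) (hχc.sub hc1) ?_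
  have hsub : tsupport (fun l => χ l - χ l * φ l) ⊆ Uᶜ := by
    refine closure_minimal (fun l hl hlU => hl ?_) hU.isClosed_compl
    simp [h1 l hlU]
  exact Set.disjoint_left.2 fun l hl hlx => hsub hl (hxU hlx)

end HomogeneousSpace

/-! ### Mild solutions: uniqueness of the forcing term, boundedness, convolution. -/

section VariationOfConstants

theorem IsStepanov.comp_sub_right {X : Type*} [NormedAddCommGroup X] {y : ℝ → X} (hy : IsStepanov y) (r : ℝ) :
    IsStepanov fun t => y (t - r) := by
  obtain ⟨C, hC, h⟩ := hy.bound
  exact ⟨hy.stronglyMeasurable.comp_measurable (by fun_prop), C, hC, fun t => by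
    simpa only [add_sub_assoc] using h (t - r)⟩

variable {X : Type*} [NormedAddCommGroup X] [NormedSpace ℂ X]

theorem integrable_opConv_of_bounded {x u : ℝ → X} (hx : StronglyMeasurable x)
    (hu : u =ᵐ[volume] x) {C : ℝ≥0∞} (hC : C ≠ ⊤) (hb : ∀ t, ‖u t‖ₑ ≤ C)
    {K : ℝ → X →L[ℂ] X} (hK : Integrable K) (t : ℝ) : Integrable fun s => K s (u (t - s)) := by
  have hqm := (Measure.measurePreserving_sub_left volume t).quasiMeasurePreserving
  refine ⟨aestronglyMeasurable_clm_apply hK.1 ?_, ?_⟩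
  · exact (hx.aestronglyMeasurable.congr hu.symm).comp_quasiMeasurePreserving hqm
  · calc ∫⁻ s, ‖K s (u (t - s))‖ₑ ≤ ∫⁻ s, ‖K s‖ₑ * C := lintegral_mono fun s =>
          ((K s).le_opENorm _).trans (mul_le_mul_right (hb _) _)
      _ = (∫⁻ s, ‖K s‖ₑ) * C := lintegral_mul_const' _ _ hC
      _ < ⊤ := ENNReal.mul_lt_top hK.2 hC.lt_top

theorem C0Semigroup.intervalIntegral_op_congr (T : C0Semigroup X) {y y' : ℝ → X}
    (h : y =ᵐ[volume] y') (s t : ℝ) :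
    ∫ τ in s..t, T.op (t - τ).toNNReal (y τ) = ∫ τ in s..t, T.op (t - τ).toNNReal (y' τ) := by
  refine intervalIntegral.integral_congr_ae ?_
  filter_upwards [h] with τ hτ _
  rw [hτ]

variable [CompleteSpace X]

theorem C0Semigroup.aestronglyMeasurable_op {α : Type*} [MeasurableSpace α] {μ : Measure α}
    (T : C0Semigroup X) {h : α → ℝ} (hh : Measurable h) {y : α → X}
    (hy : AEStronglyMeasurable y μ) :
    AEStronglyMeasurable (fun a => T.op (h a).toNNReal (y a)) μ :=
  T.continuous_uncurry_op.comp_aestronglyMeasurable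
    ((hh.real_toNNReal.stronglyMeasurable.aestronglyMeasurable).prodMk hy)

theorem C0Semigroup.exists_enorm_le (T : C0Semigroup X) (b : ℝ) :
    ∃ M : ℝ≥0∞, M ≠ ⊤ ∧ ∀ t ≤ b, ∀ v : X, ‖T.op t.toNNReal v‖ₑ ≤ M * ‖v‖ₑ := by
  obtain ⟨M, -, hM⟩ := T.exists_norm_le b.toNNReal
  refine ⟨ENNReal.ofReal M, ENNReal.ofReal_ne_top, fun t ht v => ((T.op _).le_opENorm v).trans ?_⟩
  refine mul_le_mul_left ?_ _
  rw [← ofReal_norm]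
  exact ENNReal.ofReal_le_ofReal (hM _ (Real.toNNReal_le_toNNReal ht))

theorem IsStepanov.integrableOn_op {y : ℝ → X} (hy : IsStepanov y) (T : C0Semigroup X)
    (q a b : ℝ) : IntegrableOn (fun τ => T.op (q - τ).toNNReal (y τ)) (Set.Icc a b) := by
  obtain ⟨M, hM, h⟩ := T.exists_enorm_le (q - a)
  obtain ⟨D, hD, hy'⟩ := hy.exists_lintegral_Icc_le a b
  refine ⟨T.aestronglyMeasurable_op (by fun_prop)
    hy.stronglyMeasurable.aestronglyMeasurable, ?_⟩
  calc ∫⁻ τ in Set.Icc a b, ‖T.op (q - τ).toNNReal (y τ)‖ₑ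
      ≤ ∫⁻ τ in Set.Icc a b, M * ‖y τ‖ₑ := setLIntegral_mono'
        measurableSet_Icc fun τ hτ => h _ (by linarith [hτ.1]) _
    _ = M * ∫⁻ τ in Set.Icc a b, ‖y τ‖ₑ := lintegral_const_mul' _ _ hM
    _ < ⊤ := ENNReal.mul_lt_top hM.lt_top ((by simpa using hy' 0 : _ ≤ D).trans_lt hD.lt_top)

theorem IsStepanov.intervalIntegrable_op {y : ℝ → X} (hy : IsStepanov y) (T : C0Semigroup X)
    (q a b : ℝ) : IntervalIntegrable (fun τ => T.op (q - τ).toNNReal (y τ)) volume a b :=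
  intervalIntegrable_iff.2
    ((hy.integrableOn_op T q (min a b) (max a b)).mono_set Set.Ioc_subset_Icc_self)

/-- A function whose semigroup evolutions integrate to zero over almost all intervals vanishes. -/
theorem IsStepanov.ae_eq_zero_of_integral_op {w : ℝ → X} (hw : IsStepanov w) (T : C0Semigroup X)
    {G : Set ℝ} (hG : ∀ᵐ t, t ∈ G)
    (h : ∀ s ∈ G, ∀ t ∈ G, s ≤ t → ∫ τ in s..t, T.op (t - τ).toNNReal (w τ) = 0) :
    ∀ᵐ t, w t = 0 := by
  have hd : Dense G := Measure.dense_of_ae hG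
  -- For fixed `q` the primitive vanishes to the left of `q`, by density of `G` and continuity;
  -- Lebesgue differentiation then applies.
  have h1 : ∀ q ∈ G, ∀ᵐ τ, τ < q → T.op (q - τ).toNNReal (w τ) = 0 := fun q hq => by
    have hl : LocallyIntegrable fun τ => T.op (q - τ).toNNReal (w τ) := fun t =>
      ⟨Set.Icc (t - 1) (t + 1), Icc_mem_nhds (by linarith) (by linarith), hw.integrableOn_op T _ _ _⟩
    have hcont : Continuous fun t => ∫ τ in q..t, T.op (q - τ).toNNReal (w τ) :=
      intervalIntegral.continuous_primitive (fun a b => hw.intervalIntegrable_op T q a b) q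
    have hzero : ∀ s < q, ∫ τ in q..s, T.op (q - τ).toNNReal (w τ) = 0 := by
      have hcl : Set.Iio q ⊆ {t | ∫ τ in q..t, T.op (q - τ).toNNReal (w τ) = 0} :=
        (hd.open_subset_closure_inter isOpen_Iio).trans <| closure_minimal
          (fun s hs => by
            have := h s hs.2 q hq hs.1.le
            rw [Set.mem_ofPred_eq, intervalIntegral.integral_symm, this, neg_zero])
          (isClosed_eq hcont continuous_const)
      exact fun s hs => hcl hs
    filter_upwards [LocallyIntegrable.ae_hasDerivAt_integral hl] with τ hτ hlt
    refine (hτ q).unique ((hasDerivAt_const τ (0 : X)).congr_of_eventuallyEq ?_)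
    filter_upwards [Iio_mem_nhds hlt] with s hs using hzero s hs
  -- Countably many `q` share one exceptional null set; letting `q` decrease to `τ` turns `T(q - τ)`
  -- into the identity.
  obtain ⟨D, hDG, hDc, hDd⟩ := hd.exists_countable_dense_subset
  have h2 : ∀ᵐ τ, ∀ q ∈ D, τ < q → T.op (q - τ).toNNReal (w τ) = 0 :=
    (ae_ball_iff hDc).2 fun q hq => h1 q (hDG hq)
  filter_upwards [h2] with τ hτ
  have hcl : closure (Set.Ioi τ) ⊆ {q | T.op (q - τ).toNNReal (w τ) = 0} :=
    (closure_minimal (hDd.open_subset_closure_inter isOpen_Ioi) isClosed_closure).trans <|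
      closure_minimal (fun q hq => hτ q hq.2 hq.1)
        (isClosed_eq ((T.continuous_op_toNNReal (w τ)).comp (by fun_prop)) continuous_const)
  have := hcl (by rw [closure_Ioi]; exact Set.mem_Ici.2 le_rfl : τ ∈ closure (Set.Ioi τ))
  rwa [Set.mem_ofPred_eq, sub_self, T.op_toNNReal_zero] at this

/-- The mild solutions of `u' = A u - y` that are Stepanov functions are bounded. -/
theorem IsStepanov.exists_enorm_le_of_mild {x y u : ℝ → X} (hx : IsStepanov x)
    (hy : IsStepanov y) (hu : u =ᵐ[volume] x) (T : C0Semigroup X)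
    (h : ∀ s t : ℝ, s ≤ t → u t = T.op (t - s).toNNReal (u s) -
      ∫ τ in s..t, T.op (t - τ).toNNReal (y τ)) :
    ∃ C : ℝ≥0∞, C ≠ ⊤ ∧ ∀ t, ‖u t‖ₑ ≤ C := by
  obtain ⟨M, hM, hT⟩ := T.exists_enorm_le 1
  obtain ⟨D, hD, hxD⟩ := hx.exists_lintegral_Icc_le (-1) 0
  obtain ⟨D', hD', hyD⟩ := hy.exists_lintegral_Icc_le (-1) 0
  refine ⟨M * D + M * D', by finiteness, fun t => ?_⟩
  have hle : ∀ σ ∈ Set.Icc (-1 : ℝ) 0, ‖u t‖ₑ ≤ M * ‖u (σ - -t)‖ₑ + M * D' := fun σ hσ => by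
    rw [h (σ - -t) t (by linarith [hσ.2])]
    refine enorm_sub_le.trans (add_le_add (hT _ (by linarith [hσ.1]) _) ?_)
    rw [intervalIntegral.integral_of_le (by linarith [hσ.2])]
    have e := intervalIntegral.integral_comp_sub_right
      (fun τ => T.op (t - τ).toNNReal (y τ)) (-t) (a := σ) (b := 0)
    rw [zero_sub, neg_neg] at e
    rw [← intervalIntegral.integral_of_le (by linarith [hσ.2]), ← e,
      intervalIntegral.integral_of_le hσ.2]
    calc ‖∫ τ in Set.Ioc σ 0, T.op (t - (τ - -t)).toNNReal (y (τ - -t))‖ₑ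
        ≤ ∫⁻ τ in Set.Ioc σ 0, ‖T.op (t - (τ - -t)).toNNReal (y (τ - -t))‖ₑ :=
          enorm_integral_le_lintegral_enorm _
      _ ≤ ∫⁻ τ in Set.Ioc σ 0, M * ‖y (τ - -t)‖ₑ := setLIntegral_mono' measurableSet_Ioc
          fun τ hτ => hT _ (by linarith [hτ.1, hσ.1]) _
      _ ≤ ∫⁻ τ in Set.Icc (-1) 0, M * ‖y (τ - -t)‖ₑ := lintegral_mono_set
          (Set.Ioc_subset_Icc_self.trans (Set.Icc_subset_Icc_left hσ.1))
      _ ≤ M * D' := by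
          rw [lintegral_const_mul' _ _ hM]
          exact mul_le_mul_right (hyD _) _
  -- Averaging over starting times in the preceding unit interval allows `u` to be replaced by `x`,
  -- whose integral is bounded uniformly in `t`.
  calc ‖u t‖ₑ = ∫⁻ σ in Set.Icc (-1 : ℝ) 0, ‖u t‖ₑ := by simp
    _ ≤ ∫⁻ σ in Set.Icc (-1 : ℝ) 0, (M * ‖u (σ - -t)‖ₑ + M * D') :=
        setLIntegral_mono' measurableSet_Icc hle
    _ = ∫⁻ σ in Set.Icc (-1 : ℝ) 0, (M * ‖x (σ - -t)‖ₑ + M * D') := by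
        refine setLIntegral_congr_fun_ae measurableSet_Icc ?_
        filter_upwards [(measurePreserving_sub_right volume (-t)).quasiMeasurePreserving.ae hu]
          with σ hσ _
        rw [hσ]
    _ = (M * ∫⁻ σ in Set.Icc (-1 : ℝ) 0, ‖x (σ - -t)‖ₑ) + M * D' := by
        rw [lintegral_add_right _ measurable_const, lintegral_const_mul' _ _ hM]
        simp
    _ ≤ M * D + M * D' := by gcongr; exact hxD _

/-- Convolution with a kernel that commutes with the semigroup preserves mild solutions. -/
theorem IsStepanov.opConv_mild {x y u : ℝ → X} (hx : IsStepanov x)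
    (hy : IsStepanov y) (hu : u =ᵐ[volume] x) (T : C0Semigroup X)
    (h : ∀ s t : ℝ, s ≤ t → u t = T.op (t - s).toNNReal (u s) -
      ∫ τ in s..t, T.op (t - τ).toNNReal (y τ))
    {K : ℝ → X →L[ℂ] X} (hK : Integrable K) (hKT : ∀ r a v, K r (T.op a v) = T.op a (K r v))
    {s t : ℝ} (hst : s ≤ t) :
    opConv K u t = T.op (t - s).toNNReal (opConv K u s) -
      ∫ τ in s..t, T.op (t - τ).toNNReal (opConv K y τ) := by
  -- Boundedness makes `K * u` converge at every time, as the pointwise equation requires.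
  obtain ⟨C, hC, hb⟩ := hx.exists_enorm_le_of_mild hy hu T h
  have hint := integrable_opConv_of_bounded hx.stronglyMeasurable hu hC hb hK
  have hy' := hy.stronglyMeasurable
  have hprod : Integrable (Function.uncurry fun τ ρ : ℝ =>
      T.op (t - τ).toNNReal (K ρ (y (τ - ρ)))) ((volume.restrict (Set.Ioc s t)).prod volume) := by
    have hm : AEStronglyMeasurable (Function.uncurry fun τ ρ : ℝ =>
        T.op (t - τ).toNNReal (K ρ (y (τ - ρ))))
        ((volume.restrict (Set.Ioc s t)).prod volume) :=
      T.aestronglyMeasurable_op (h := fun p : ℝ × ℝ => t - p.1) (by fun_prop)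
        (aestronglyMeasurable_clm_apply hK.1.comp_snd
          (StronglyMeasurable.aestronglyMeasurable (by fun_prop)))
    refine ⟨hm, ?_⟩
    obtain ⟨M, hM, hT⟩ := T.exists_enorm_le (t - s)
    obtain ⟨D, hD, hyD⟩ := hy.lintegral_Icc_conv_le s t
    rw [HasFiniteIntegral, lintegral_prod _ hm.enorm]
    calc ∫⁻ τ in Set.Ioc s t, ∫⁻ ρ, ‖T.op (t - τ).toNNReal (K ρ (y (τ - ρ)))‖ₑ
        ≤ ∫⁻ τ in Set.Ioc s t, M * ∫⁻ ρ, ‖K ρ‖ₑ * ‖y (τ - ρ)‖ₑ :=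
          setLIntegral_mono' measurableSet_Ioc fun τ hτ => by
            rw [← lintegral_const_mul' _ _ hM]
            exact lintegral_mono fun ρ => (hT _ (by linarith [hτ.1]) _).trans
              (mul_le_mul_right ((K ρ).le_opENorm _) _)
      _ = M * ∫⁻ τ in Set.Ioc s t, ∫⁻ ρ, ‖K ρ‖ₑ * ‖y (τ - ρ)‖ₑ := lintegral_const_mul' _ _ hM
      _ ≤ M * ((∫⁻ ρ, ‖K ρ‖ₑ) * D) := mul_le_mul_right
          ((lintegral_mono_set Set.Ioc_subset_Icc_self).trans (hyD _ hK.1.enorm)) _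
      _ < ⊤ := ENNReal.mul_lt_top hM.lt_top (ENNReal.mul_lt_top hK.2 hD.lt_top)
  have hpt : ∀ ρ, K ρ (u (t - ρ)) = T.op (t - s).toNNReal (K ρ (u (s - ρ))) -
      ∫ τ in Set.Ioc s t, T.op (t - τ).toNNReal (K ρ (y (τ - ρ))) := fun ρ => by
    rw [h (s - ρ) (t - ρ) (by linarith), sub_sub_sub_cancel_right, map_sub, hKT]
    congr 1
    have e := intervalIntegral.integral_comp_sub_right
      (fun τ => T.op (t - ρ - τ).toNNReal (y τ)) ρ (a := s) (b := t)
    have hi := (hy.comp_sub_right ρ).intervalIntegrable_op T t s t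
    simp only [sub_sub_sub_cancel_right] at e
    rw [← e, ← (K ρ).intervalIntegral_comp_comm hi, intervalIntegral.integral_of_le hst]
    simp only [hKT]
  rw [opConv]
  simp only [hpt]
  have hI := hprod.integral_prod_right
  simp only [Function.uncurry_apply_pair] at hI
  rw [integral_sub ((T.op _).integrable_comp (hint s)) hI,
    (T.op _).integral_comp_comm (hint s), intervalIntegral.integral_of_le hst,
    ← integral_integral_swap hprod]
  congr 1
  refine integral_congr_ae (ae_restrict_of_ae ?_)
  filter_upwards [hy.ae_integrable_opConv hK] with τ hτ
  exact (T.op _).integral_comp_comm hτ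

end VariationOfConstants

/-! ### The resolvent kernel and its mild equation. -/

section ResolventKernel

variable {X : Type*} [NormedAddCommGroup X] [NormedSpace ℂ X]

theorem resolventKernel_eq_fourierSynthesis (A : X →ₗ.[ℂ] X) (φ : ℝ → ℂ) :
    resolventKernel A φ =
      fourierSynthesis fun l : ℝ => φ l • unboundedResolvent A (Complex.I * l) := by
  ext1 t
  simp only [resolventKernel, fourierSynthesis, smul_smul, mul_comm (φ _)]

namespace IsSpectralCutoff

variable {A : X →ₗ.[ℂ] X} {Δ : Set ℝ} {φ : ℝ → ℂ}

theorem hasCompactSupport_smul_resolvent (hφ : IsSpectralCutoff A Δ φ) :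
    HasCompactSupport fun l : ℝ => φ l • unboundedResolvent A (Complex.I * l) :=
  hφ.compact_support.smul_right

theorem integrable (hφ : IsSpectralCutoff A Δ φ) : Integrable φ :=
  hφ.smooth.continuous.integrable_of_hasCompactSupport hφ.compact_support

variable [CompleteSpace X]

theorem contDiff_smul_resolvent (hφ : IsSpectralCutoff A Δ φ) :
    ContDiff ℝ ∞ fun l : ℝ => φ l • unboundedResolvent A (Complex.I * l) := by
  refine contDiff_iff_contDiffAt.2 fun l => ?_
  by_cases hl : l ∈ tsupport φ
  swap
  · refine (contDiffAt_const (c := (0 : X →L[ℂ] X))).congr_of_eventuallyEq ?_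
    filter_upwards [(isClosed_tsupport φ).isOpen_compl.mem_nhds hl] with r hr
    rw [image_eq_zero_of_notMem_tsupport hr, zero_smul]
  have hl' := hφ.support_resolvent l hl
  refine hφ.smooth.contDiffAt.smul ?_
  have h1 : ContDiffAt ℝ ∞ (fun l : ℝ => Complex.I * (l : ℂ)) l :=
    (contDiff_const.mul Complex.ofRealCLM.contDiff).contDiffAt
  exact ContDiffAt.comp l (g := fun w => unboundedResolvent A w)
    ((contDiffAt_unboundedResolvent hl').restrict_scalars ℝ) h1

theorem integrable_smul_resolvent (hφ : IsSpectralCutoff A Δ φ) :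
    Integrable fun l : ℝ => φ l • unboundedResolvent A (Complex.I * l) :=
  hφ.contDiff_smul_resolvent.continuous.integrable_of_hasCompactSupport
    hφ.hasCompactSupport_smul_resolvent

theorem integrable_resolventKernel (hφ : IsSpectralCutoff A Δ φ) :
    Integrable (resolventKernel A φ) := by
  rw [resolventKernel_eq_fourierSynthesis]
  exact hφ.hasCompactSupport_smul_resolvent.integrable_fourierSynthesis hφ.contDiff_smul_resolvent

theorem integrable_exp_smul_resolvent (hφ : IsSpectralCutoff A Δ φ) (t : ℝ) :
    Integrable fun l : ℝ => Complex.exp (Complex.I * l * t) •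
      φ l • unboundedResolvent A (Complex.I * l) :=
  hφ.integrable_smul_resolvent.exp_smul t

theorem resolventKernel_apply (hφ : IsSpectralCutoff A Δ φ) (t : ℝ) (v : X) :
    resolventKernel A φ t v = ((2 * Real.pi : ℝ) : ℂ)⁻¹ • ∫ l : ℝ,
      Complex.exp (Complex.I * l * t) • φ l • unboundedResolvent A (Complex.I * l) v := by
  rw [resolventKernel_eq_fourierSynthesis, fourierSynthesis, smul_apply,
    ContinuousLinearMap.integral_apply (hφ.integrable_exp_smul_resolvent t)]
  rfl

variable {T : C0Semigroup X}

theorem resolventKernel_op_comm (hφ : IsSpectralCutoff T.generator Δ φ) (t : ℝ) (a : ℝ≥0) (v : X) :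
    resolventKernel T.generator φ t (T.op a v) = T.op a (resolventKernel T.generator φ t v) := by
  have hi := (hφ.integrable_exp_smul_resolvent t).apply_continuousLinearMap v
  simp only [smul_apply] at hi
  rw [hφ.resolventKernel_apply, hφ.resolventKernel_apply, map_smul,
    ← ContinuousLinearMap.integral_comp_comm (T.op a) hi]
  congr 2 with l
  simp only [map_smul]
  by_cases hl : l ∈ tsupport φ
  · rw [T.resolvent_op_comm (isResolventAt_unboundedResolvent (hφ.support_resolvent l hl))]
  · simp [image_eq_zero_of_notMem_tsupport hl]

/-- The resolvent kernel solves `F' = A F - ψ` in the mild sense. -/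
theorem resolventKernel_mild (hφ : IsSpectralCutoff T.generator Δ φ) {s t : ℝ} (hst : s ≤ t)
    (v : X) : resolventKernel T.generator φ t v =
      T.op (t - s).toNNReal (resolventKernel T.generator φ s v) -
        ∫ τ in s..t, fourierSynthesis φ τ • T.op (t - τ).toNNReal v := by
  have hprod : Integrable (Function.uncurry fun l τ : ℝ =>
      Complex.exp (Complex.I * l * τ) • φ l • T.op (t - τ).toNNReal v)
      (volume.prod (volume.restrict (Set.Ioc s t))) := by
    have hc := T.continuous_op_toNNReal v
    have h2 : Integrable (fun τ => T.op (t - τ).toNNReal v) (volume.restrict (Set.Ioc s t)) :=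
      ((hc.comp (continuous_const.sub continuous_id)).integrableOn_Icc).mono_set
        Set.Ioc_subset_Icc_self
    refine (hφ.integrable.smul_prod h2).mono ?_ (ae_of_all _ fun p => ?_)
    · exact AEStronglyMeasurable.smul (Continuous.aestronglyMeasurable (by fun_prop))
        (hφ.integrable.1.comp_fst.smul h2.1.comp_snd)
    · simp only [Function.uncurry, norm_smul, norm_exp_I_mul, one_mul, le_refl]
  -- On the support of `φ` this is the exponential solution at `z = il`, scaled by `φ(l)`; elsewhere
  -- every term is zero.
  have hpt : ∀ l : ℝ, Complex.exp (Complex.I * l * t) • φ l •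
        unboundedResolvent T.generator (Complex.I * l) v =
      T.op (t - s).toNNReal (Complex.exp (Complex.I * l * s) • φ l •
        unboundedResolvent T.generator (Complex.I * l) v) -
      ∫ τ in Set.Ioc s t, Complex.exp (Complex.I * l * τ) • φ l • T.op (t - τ).toNNReal v :=
    fun l => by
      by_cases hl : l ∈ tsupport φ
      · have := T.exp_smul_resolvent
          (isResolventAt_unboundedResolvent (hφ.support_resolvent l hl)) hst v
        simp only [smul_comm _ (φ l)]
        rw [this, smul_sub, map_smul (T.op (t - s).toNNReal) (φ l), integral_smul, intervalIntegral.integral_of_le hst]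
      · simp [image_eq_zero_of_notMem_tsupport hl]
  have hi := (hφ.integrable_exp_smul_resolvent s).apply_continuousLinearMap v
  have hI := hprod.integral_prod_left
  simp only [smul_apply] at hi
  simp only [Function.uncurry_apply_pair] at hI
  rw [hφ.resolventKernel_apply, hφ.resolventKernel_apply]
  simp only [hpt]
  rw [integral_sub ((T.op (t - s).toNNReal).integrable_comp hi) hI,
    (T.op (t - s).toNNReal).integral_comp_comm hi, smul_sub, map_smul, intervalIntegral.integral_of_le hst, integral_integral_swap hprod,
    ← integral_smul]
  congr 2 with τ
  rw [fourierSynthesis, smul_assoc, ← integral_smul_const]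
  simp only [smul_assoc]

/-- `F * y` is a mild solution of the equation with right-hand side `ψ * y`. -/
theorem opConv_resolventKernel_mild (hφ : IsSpectralCutoff T.generator Δ φ) {y : ℝ → X}
    (hy : IsStepanov y) {s t : ℝ} (hst : s ≤ t) :
    opConv (resolventKernel T.generator φ) y t =
      T.op (t - s).toNNReal (opConv (resolventKernel T.generator φ) y s) -
        ∫ τ in s..t, T.op (t - τ).toNNReal (scalarConv (fourierSynthesis φ) y τ) := by
  set K := resolventKernel T.generator φ with hKdef
  set ψ := fourierSynthesis φ with hψdef
  have hψc : Continuous ψ := hφ.compact_support.continuous_fourierSynthesis hφ.smooth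
  have hψi : Integrable ψ := hφ.compact_support.integrable_fourierSynthesis hφ.smooth
  have hy' := hy.stronglyMeasurable
  have hint : ∀ t, Integrable fun r => K (t - r) (y r) := fun t => by
    obtain ⟨C, -, hC⟩ := hφ.hasCompactSupport_smul_resolvent.exists_norm_fourierSynthesis_le
      hφ.contDiff_smul_resolvent
    rw [← resolventKernel_eq_fourierSynthesis] at hC
    simpa using (hy.integrable_opConv_of_decay hφ.integrable_resolventKernel.1 hC t).comp_sub_left t
  -- With the time variable in the kernel, the mild equation for `K` applies for each `r` to the
  -- fixed vector `y r`.
  have hsub : ∀ t, opConv K y t = ∫ r, K (t - r) (y r) := fun t => by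
    rw [opConv, ← integral_sub_left_eq_self _ volume t]
    simp
  have hprod : Integrable (Function.uncurry fun τ r : ℝ =>
      ψ (τ - r) • T.op (t - τ).toNNReal (y r)) ((volume.restrict (Set.Ioc s t)).prod volume) := by
    have hm : AEStronglyMeasurable (Function.uncurry fun τ r : ℝ =>
        ψ (τ - r) • T.op (t - τ).toNNReal (y r))
        ((volume.restrict (Set.Ioc s t)).prod volume) :=
      AEStronglyMeasurable.smul (Continuous.aestronglyMeasurable (by fun_prop))
        (T.aestronglyMeasurable_op (h := fun p : ℝ × ℝ => t - p.1) (by fun_prop)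
          (StronglyMeasurable.aestronglyMeasurable (by fun_prop)))
    refine ⟨hm, ?_⟩
    obtain ⟨M, hM, hT⟩ := T.exists_enorm_le (t - s)
    obtain ⟨D, hD, hyD⟩ := hy.lintegral_Icc_conv_le s t
    rw [HasFiniteIntegral, lintegral_prod _ hm.enorm]
    calc ∫⁻ τ in Set.Ioc s t, ∫⁻ r, ‖ψ (τ - r) • T.op (t - τ).toNNReal (y r)‖ₑ
        ≤ ∫⁻ τ in Set.Ioc s t, M * ∫⁻ ρ, ‖ψ ρ‖ₑ * ‖y (τ - ρ)‖ₑ :=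
          setLIntegral_mono' measurableSet_Ioc fun τ hτ => by
            rw [← lintegral_const_mul' _ _ hM, ← lintegral_sub_left_eq_self _ τ]
            refine lintegral_mono fun r => ?_
            rw [sub_sub_cancel, enorm_smul, mul_left_comm]
            exact mul_le_mul_right (hT _ (by linarith [hτ.1]) _) _
      _ = M * ∫⁻ τ in Set.Ioc s t, ∫⁻ ρ, ‖ψ ρ‖ₑ * ‖y (τ - ρ)‖ₑ := lintegral_const_mul' _ _ hM
      _ ≤ M * ((∫⁻ ρ, ‖ψ ρ‖ₑ) * D) := mul_le_mul_right
          ((lintegral_mono_set Set.Ioc_subset_Icc_self).trans (hyD _ hψi.1.enorm)) _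
      _ < ⊤ := ENNReal.mul_lt_top hM.lt_top (ENNReal.mul_lt_top hψi.2 hD.lt_top)
  have hpt : ∀ r, K (t - r) (y r) = T.op (t - s).toNNReal (K (s - r) (y r)) -
      ∫ τ in Set.Ioc s t, ψ (τ - r) • T.op (t - τ).toNNReal (y r) := fun r => by
    have e := intervalIntegral.integral_comp_sub_right
      (fun τ => ψ τ • T.op (t - r - τ).toNNReal (y r)) r (a := s) (b := t)
    simp only [sub_sub_sub_cancel_right] at e
    rw [hKdef, hφ.resolventKernel_mild (sub_le_sub_right hst r), sub_sub_sub_cancel_right, ← e,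
      intervalIntegral.integral_of_le hst]
  rw [hsub, hsub]
  simp only [hpt]
  have hI := hprod.integral_prod_right
  simp only [Function.uncurry_apply_pair] at hI
  rw [integral_sub ((T.op _).integrable_comp (hint s)) hI,
    (T.op _).integral_comp_comm (hint s), intervalIntegral.integral_of_le hst,
    ← integral_integral_swap hprod]
  congr 1
  refine integral_congr_ae (ae_restrict_of_ae ?_)
  filter_upwards [hy.ae_integrable_opConv (hψi.smul_const (1 : X →L[ℂ] X))] with τ hτ
  have hτ' : Integrable fun r => ψ r • y (τ - r) := hτ
  simp only [scalarConv]
  rw [← (T.op _).integral_comp_comm hτ', ← integral_sub_left_eq_self _ volume τ]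
  simp

end IsSpectralCutoff

end ResolventKernel

/-! ### The parabolic operator on a spectral submodule. -/

namespace HomogeneousSpace

variable {X E : Type*} [NormedAddCommGroup X] [NormedSpace ℂ X]
  [NormedAddCommGroup E] [NormedSpace ℂ E] (F : HomogeneousSpace X E) {T : C0Semigroup X}

theorem zero_mem_spectralSubmodule (Δ : Set ℝ) : (0 : E) ∈ F.spectralSubmodule Δ := by
  intro l hl
  refine absurd ?_ hl
  obtain ⟨φ, hs, hc, -, V, -, hV, h1⟩ := exists_smooth_cutoff (isCompact_singleton (x := l))
    isOpen_univ (Set.subset_univ _)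
  have hi := hc.integrable_fourierSynthesis hs
  refine ⟨_, hi, ?_, (F.sact_eq_zero_iff hi 0).1 (F.sact_zero hi)⟩
  rw [scalarFourier_fourierSynthesis hc hs, h1 l (hV rfl)]
  exact one_ne_zero

theorem parabolicGraph_zero : F.ParabolicGraph T 0 0 := by
  refine ⟨fun _ => 0, F.toAE_zero_ae.symm, fun s t _ => ?_⟩
  rw [T.intervalIntegral_op_congr F.toAE_zero_ae]
  simp

variable [CompleteSpace X]

variable {F}

/-- The two representatives agree off a null set; for endpoints outside it, subtracting the
equations leaves only the evolution integral of `y - y'`. -/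
theorem ParabolicGraph.unique {x y y' : E} (h : F.ParabolicGraph T x y)
    (h' : F.ParabolicGraph T x y') : y = y' := by
  obtain ⟨u, hu, hm⟩ := h
  obtain ⟨u', hu', hm'⟩ := h'
  have hw := (F.isStepanov (y - y')).ae_eq_zero_of_integral_op T (G := {t | u t = u' t})
    (by filter_upwards [hu, hu'] with t h1 h2 using h1.trans h2.symm) fun s hs t ht hst => by
      have e := hm s t hst
      have hs' : u s = u' s := hs
      have ht' : u t = u' t := ht
      rw [hs', ht', hm' s t hst] at e
      rw [T.intervalIntegral_op_congr (F.toAE_sub_ae y y')]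
      simp only [map_sub]
      rw [intervalIntegral.integral_sub ((F.isStepanov y).intervalIntegrable_op T t s t)
        ((F.isStepanov y').intervalIntegrable_op T t s t), sub_right_inj.1 e, sub_self]
  refine sub_eq_zero.1 (F.ext_ae ?_)
  filter_upwards [hw, F.toAE_zero_ae] with t h1 h2
  rw [h1, h2]

theorem ParabolicGraph.act {x y : E} (h : F.ParabolicGraph T x y) {K : ℝ → X →L[ℂ] X}
    (hK : Integrable K) (hKT : ∀ r a v, K r (T.op a v) = T.op a (K r v)) :
    F.ParabolicGraph T (F.act K x) (F.act K y) := by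
  obtain ⟨u, hu, hm⟩ := h
  refine ⟨opConv K u, ?_, fun s t hst => ?_⟩
  · filter_upwards [F.toAE_act hK x] with t ht
    rw [ht, opConv_congr_ae hu]
  · rw [T.intervalIntegral_op_congr (F.toAE_act hK y)]
    exact (F.isStepanov x).opConv_mild (F.isStepanov y) hu T hm hK hKT hst

theorem ParabolicGraph.sact {x y : E} (h : F.ParabolicGraph T x y) {f : ℝ → ℂ}
    (hf : Integrable f) : F.ParabolicGraph T (F.sact f x) (F.sact f y) :=
  h.act (hf.smul_const _) fun r a v => by simp

theorem ParabolicGraph.beurlingSpectrum_subset {x y : E} (h : F.ParabolicGraph T x y) :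
    F.beurlingSpectrum y ⊆ F.beurlingSpectrum x :=
  F.beurlingSpectrum_subset_of_sact fun f hf h0 => by
    have := h.sact hf
    rw [h0] at this
    exact this.unique F.parabolicGraph_zero

variable (F)

theorem parabolicGraph_resolventKernel {Δ : Set ℝ} {φ : ℝ → ℂ}
    (hφ : IsSpectralCutoff T.generator Δ φ) (y : E) :
    F.ParabolicGraph T (F.act (resolventKernel T.generator φ) y)
      (F.sact (fourierSynthesis φ) y) := by
  refine ⟨_, (F.toAE_act hφ.integrable_resolventKernel y).symm, fun s t hst => ?_⟩
  rw [T.intervalIntegral_op_congr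
    (F.toAE_sact (hφ.compact_support.integrable_fourierSynthesis hφ.smooth) y)]
  exact hφ.opConv_resolventKernel_mild (F.isStepanov y) hst

variable {F}

theorem sact_fourierSynthesis_eq_self_of_mem {Δ : Set ℝ} {A : X →ₗ.[ℂ] X} {φ : ℝ → ℂ}
    (hφ : IsSpectralCutoff A Δ φ) {y : E} (hy : y ∈ F.spectralSubmodule Δ) :
    F.sact (fourierSynthesis φ) y = y := by
  obtain ⟨U, hU, hΔU, h1⟩ := hφ.eq_one
  exact F.sact_fourierSynthesis_eq_self hφ.smooth hφ.compact_support hU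
    (Set.Subset.trans hy hΔU) h1

theorem parabolicGraphIn_resolventKernel {Δ : Set ℝ} {φ : ℝ → ℂ}
    (hφ : IsSpectralCutoff T.generator Δ φ) {y : E} (hy : y ∈ F.spectralSubmodule Δ) :
    F.ParabolicGraphIn T (F.spectralSubmodule Δ)
      (F.act (resolventKernel T.generator φ) y) y := by
  refine ⟨Set.Subset.trans (F.beurlingSpectrum_subset_of_sact fun f hf h0 => ?_) hy, hy, ?_⟩
  · rw [F.sact_act_comm hf hφ.integrable_resolventKernel, h0,
      F.act_zero hφ.integrable_resolventKernel]
  · have := F.parabolicGraph_resolventKernel hφ y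
    rwa [sact_fourierSynthesis_eq_self_of_mem hφ hy] at this

/-- Both `0` and `x` are images of `F * x`: the first because convolution preserves the graph, the
second because `ψ * x = x`. -/
theorem ParabolicGraph.eq_zero_of_mem {Δ : Set ℝ} {φ : ℝ → ℂ}
    (hφ : IsSpectralCutoff T.generator Δ φ) {x : E} (hx : x ∈ F.spectralSubmodule Δ)
    (h : F.ParabolicGraph T x 0) : x = 0 := by
  have h1 := h.act hφ.integrable_resolventKernel hφ.resolventKernel_op_comm
  rw [F.act_zero hφ.integrable_resolventKernel] at h1
  have h2 := F.parabolicGraph_resolventKernel hφ x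
  rw [sact_fourierSynthesis_eq_self_of_mem hφ hx] at h2
  exact h2.unique h1

end HomogeneousSpace

theorem exists_isSpectralCutoff {X : Type*} [NormedAddCommGroup X] [NormedSpace ℂ X]
    [CompleteSpace X] (A : X →ₗ.[ℂ] X) {Δ : Set ℝ} (hΔ : IsCompact Δ)
    (hA : ((fun l : ℝ => Complex.I * (l : ℂ)) '' Δ) ∩ unboundedSpectrum A = ∅) :
    ∃ φ : ℝ → ℂ, IsSpectralCutoff A Δ φ := by
  have hU : IsOpen {l : ℝ | Complex.I * (l : ℂ) ∈ unboundedResolventSet A} :=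
    (isOpen_unboundedResolventSet A).preimage (by fun_prop)
  obtain ⟨φ, hs, hc, hsub, V, hV, hΔV, h1⟩ := exists_smooth_cutoff hΔ hU fun l hl => by
    by_contra hn
    exact (Set.eq_empty_iff_forall_notMem.1 hA) _ ⟨⟨l, hl, rfl⟩, hn⟩
  exact ⟨φ, hs, hc, ⟨V, hV, hΔV, h1⟩, fun l hl => hsub hl⟩

theorem theorem3p3 {X E : Type*}
    [NormedAddCommGroup X] [NormedSpace ℂ X] [CompleteSpace X]
    [NormedAddCommGroup E] [NormedSpace ℂ E] [CompleteSpace E]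
    (F : HomogeneousSpace X E) (T : C0Semigroup X) (Δ : Set ℝ) (hΔ : IsCompact Δ)
    (hA : ((fun l : ℝ => Complex.I * (l : ℂ)) '' Δ) ∩ unboundedSpectrum T.generator = ∅) :
    (∀ x ∈ F.spectralSubmodule Δ, ∀ y, F.ParabolicGraph T x y → y ∈ F.spectralSubmodule Δ) ∧
    IsInvertibleGraph (F.ParabolicGraphIn T (F.spectralSubmodule Δ)) (F.spectralSubmodule Δ) ∧
    (∃ φ : ℝ → ℂ, IsSpectralCutoff T.generator Δ φ) ∧
    ∀ φ : ℝ → ℂ, IsSpectralCutoff T.generator Δ φ →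
      Integrable (resolventKernel T.generator φ) ∧
      ∀ y ∈ F.spectralSubmodule Δ, ∃ x : E,
        (∀ᵐ t : ℝ, F.toAE x t = opConv (resolventKernel T.generator φ) (F.toAE y) t) ∧
        F.ParabolicGraphIn T (F.spectralSubmodule Δ) x y := by
  obtain ⟨φ, hφ⟩ := exists_isSpectralCutoff T.generator hΔ hA
  have h0 := F.zero_mem_spectralSubmodule Δ
  refine ⟨fun x hx y h => Set.Subset.trans h.beurlingSpectrum_subset hx,
    ⟨fun x y y' h h' => h.2.2.unique h'.2.2, ?_, ?_⟩, ⟨φ, hφ⟩, fun φ hφ =>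
      ⟨hφ.integrable_resolventKernel, fun y hy => ⟨_, F.toAE_act hφ.integrable_resolventKernel y,
        HomogeneousSpace.parabolicGraphIn_resolventKernel hφ hy⟩⟩⟩
  · ext x
    refine ⟨fun h => h.2.2.eq_zero_of_mem hφ h.1, ?_⟩
    rintro rfl
    exact ⟨h0, h0, F.parabolicGraph_zero⟩
  · ext y
    exact ⟨fun ⟨x, h⟩ => h.2.1,
      fun hy => ⟨_, HomogeneousSpace.parabolicGraphIn_resolventKernel hφ hy⟩⟩
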